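/- Let $G$ be an infinite, connected, locally finite graph on a countable vertex set $\mathbb V$, and let a group $\Gamma$ act on $\mathbb V$ by automorphisms of $G$ with finitely many orbits (quasi-transitively). Let $(S,\le)$ be a countable totally ordered set with the discrete topology and $\Omega=S^{\mathbb V}$ with the product topology and product order; $\Gamma$ acts by $(\gamma\omega)_v=\omega_{\gamma^{-1}v}$. For finite $V\subset\mathbb V$ and $\tau\in\Omega$ put $\Omega_V^\tau=\{\omega:\omega=\tau\text{ off }V\}$. If $S$ has a maximal element $+$ (minimal element $-$), let $\boldsymbol{+}$ ($\boldsymbol{-}$) be the corresponding constant configuration and $\Omega^{+}$ ($\Omega^-$) the set of configurations equal to it off a finite set. An *upwards specification* is a family $\rho=(\rho_V^\tau)$ of probability measures on $\Omega$, indexed by finite $V\subset\mathbb V$ and $\tau\in\Omega^+$, such that $\rho_V^\tau(\Omega_V^\tau)=1$, $\rho_V^\tau=\rho_V^{\tau'}$ if $\tau=\tau'$ off $V$, and $\rho_V^\tau(\cdot\mid\Omega_U^\tau)=\rho_U^\tau$ whenever $U\subset V$ and $\rho_V^\tau(\Omega_U^\tau)>0$. An *upwards-downwards specification* is defined in the same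 way with $\Omega^+\cup\Omega^-$ in place of $\Omega^+$. Such a $\rho$ is *monotone* if $\rho_V^\tau\le_{\rm st}\rho_V^{\tau'}$ (stochastic domination) whenever $\tau\le\tau'$ are admissible boundary conditions; *$\Gamma$-invariant* if $\rho_V^\tau$ is the law of $\gamma^{-1}\omega$ under $\rho_{\gamma V}^{\gamma\tau}$ for all $\gamma\in\Gamma$; and *irreducible* if for every finite $V$ the set $\{\omega:\rho_V^{\boldsymbol{+}}(\omega)>0\}$ contains $\boldsymbol{+}$ and is connected in the Hamming graph (configurations adjacent when they differ at exactly one vertex) and, in the upwards-downwards case, the same also holds with $\boldsymbol{-}$ in place of $\boldsymbol{+}$. Let $\mu^{\pm}=\lim_{V\uparrow\mathbb V}\rho_V^{\boldsymbol{\pm}}$ denote the weak limits along finite $V$ ordered by inclusion; "$\mu^+$ is a probability measure" means that $\rho_V^{\boldsymbol{+}}$ converges weakly to a probability measure on $\Omega$. A probability measure $\mu$ on $\Omega$ is *$\Gamma$-fiid* if there are an i.i.d. process $Y=(Y_v)_{v\in\mathbb V}$ with values in a standard Borel space $T$ and a measurable $\varphi:T^{\mathbb V}\to\Omega$ (a *coding*)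 such that $\varphi(Y)$ has law $\mu$ and $\varphi$ commutes with every element of $\Gamma$ on a $\Gamma$-invariant set of full measure. The *coding radius* $R_v(y)\in\{0,1,\dots,\infty\}$ is the least $r$ such that $\varphi(y')_v=\varphi(y)_v$ for every $y'$ which agrees with $y$ on the ball $\mathbb V_{v,r}=\{u:\operatorname{dist}(u,v)\le r\}$; write $R_v=R_v(Y)$. The coding is *finitary* if $R_v<\infty$ almost surely for every $v$. **Theorem 2.1.** 1. Suppose that $S$ has a maximal element, and let $\rho$ be a monotone $\Gamma$-invariant irreducible upwards specification. If $\mu^+$ is a probability measure, then $\mu^+$ is $\Gamma$-fiid. 2. Suppose that $S$ is finite and non-empty, and let $\rho$ be a monotone $\Gamma$-invariant irreducible upwards-downwards specification. Then $\mu^+$ and $\mu^-$ exist and are probability measures, and $\mu^+$ is $\Gamma$-fiid by means of a coding whose coding radius satisfies $$\Pr(R_v>r)\le(|S|-1)\cdot\big\|\rho^{\boldsymbol{+}}_{\mathbb V_{v,r}}(\sigma_v\in\cdot)-\rho^{\boldsymbol{-}}_{\mathbb V_{v,r}}(\sigma_v\in\cdot)\big\|_{TV}\qquad\text{for all }v\in\mathbb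 V,\ r\ge0,$$ where $\|p-q\|_{TV}=\tfrac12\sum_{s\in S}|p(s)-q(s)|$ and $\Pr$ is read as an outer probability if $R_v$ is not measurable. In particular, if $\mu^+=\mu^-$, then this coding is finitary. -/

import Mathlib

open MeasureTheory ProbabilityTheory Filter Topology

namespace SpinSpec

section Action

variable {Γ 𝕍 A : Type*} [Group Γ] [MulAction Γ 𝕍]

/-- The action on configurations, `(γω)_v = ω_{γ⁻¹ v}`. -/
def shift (γ : Γ) (ω : 𝕍 → A) : 𝕍 → A := fun v => ω (γ⁻¹ • v)

/-- The image `γV` of a finite set of vertices. -/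
def smulFinset (γ : Γ) (V : Finset 𝕍) : Finset 𝕍 := V.map (MulAction.toPerm γ).toEmbedding

/-- An action is quasi-transitive if it has finitely many orbits. -/
def QuasiTransitive (Γ 𝕍 : Type*) [Group Γ] [MulAction Γ 𝕍] : Prop :=
  Finite (MulAction.orbitRel.Quotient Γ 𝕍)

/-- The group acts by automorphisms of the graph. -/
def ActsByAut (Γ : Type*) {𝕍 : Type*} [Group Γ] [MulAction Γ 𝕍] (G : SimpleGraph 𝕍) : Prop :=
  ∀ (γ : Γ) (u v : 𝕍), G.Adj (γ • u) (γ • v) ↔ G.Adj u v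

end Action

section Graph

variable {𝕍 : Type*} (G : SimpleGraph 𝕍)

/-- Every vertex has finitely many neighbours. -/
def IsLocallyFinite : Prop := ∀ v, (G.neighborSet v).Finite

/-- The set of vertices at graph distance at most `r` from `v`. -/
def ballSet (v : 𝕍) (r : ℕ) : Set 𝕍 := {u | G.edist v u ≤ r}

theorem ballSet_finite {G : SimpleGraph 𝕍} (hG : IsLocallyFinite G) (v : 𝕍) (r : ℕ) :
    (ballSet G v r).Finite := by
  have key : ∀ (r : ℕ) (v : 𝕍), {u | ∃ p : G.Walk v u, p.length ≤ r}.Finite := by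
    intro r
    induction r with
    | zero =>
      intro v
      refine (Set.finite_singleton v).subset ?_
      rintro u ⟨p, hp⟩
      exact (SimpleGraph.Walk.eq_of_length_eq_zero (Nat.le_zero.mp hp)).symm
    | succ r ih =>
      intro v
      refine ((Set.finite_singleton v).union ((hG v).biUnion fun w _ => ih w)).subset ?_
      rintro u ⟨p, hp⟩
      cases p with
      | nil => exact Or.inl rfl
      | cons h q =>
        refine Or.inr (Set.mem_biUnion h ⟨q, ?_⟩)
        simpa using hp
  refine (key r v).subset ?_
  intro u hu
  have hu' : G.edist v u ≤ r := hu
  obtain ⟨p, hp⟩ := SimpleGraph.exists_walk_of_edist_ne_top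
    (ne_top_of_le_ne_top (ENat.natCast_ne_top r) hu')
  refine ⟨p, ?_⟩
  rw [← hp] at hu'
  exact_mod_cast hu'

/-- The finite ball `𝕍_{v,r}` of a locally finite graph. -/
noncomputable def ball {G : SimpleGraph 𝕍} (hG : IsLocallyFinite G) (v : 𝕍) (r : ℕ) : Finset 𝕍 :=
  (ballSet_finite hG v r).toFinset

end Graph

section Configurations

variable {𝕍 S : Type*}

/-- `Ω_V^τ`: the configurations which agree with `τ` outside `V`. -/
def agreeOff (V : Finset 𝕍) (τ : 𝕍 → S) : Set (𝕍 → S) := {ω | ∀ v, v ∉ V → ω v = τ v}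

/-- `Ω⁺`: the configurations which agree with the all-maximal one outside a finite set. -/
def upConfigs (𝕍 S : Type*) [LE S] [OrderTop S] : Set (𝕍 → S) :=
  ⋃ V : Finset 𝕍, agreeOff V (fun _ => ⊤)

/-- `Ω⁻`: the configurations which agree with the all-minimal one outside a finite set. -/
def downConfigs (𝕍 S : Type*) [LE S] [OrderBot S] : Set (𝕍 → S) :=
  ⋃ V : Finset 𝕍, agreeOff V (fun _ => ⊥)

theorem top_mem_upConfigs (𝕍 S : Type*) [LE S] [OrderTop S] :
    (fun _ => ⊤ : 𝕍 → S) ∈ upConfigs 𝕍 S :=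
  Set.mem_iUnion.2 ⟨∅, fun _ _ => rfl⟩

theorem bot_mem_downConfigs (𝕍 S : Type*) [LE S] [OrderBot S] :
    (fun _ => ⊥ : 𝕍 → S) ∈ downConfigs 𝕍 S :=
  Set.mem_iUnion.2 ⟨∅, fun _ _ => rfl⟩

/-- The Hamming graph: two configurations are adjacent if they differ at exactly one vertex. -/
def hammingGraph (𝕍 S : Type*) : SimpleGraph (𝕍 → S) where
  Adj ω ω' := ∃! v, ω v ≠ ω' v
  symm := ⟨fun ω ω' h => by
    obtain ⟨v, hv, hu⟩ := h
    exact ⟨v, hv.symm, fun w hw => hu w (Ne.symm hw)⟩⟩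
  loopless := ⟨fun ω h => by
    obtain ⟨v, hv, -⟩ := h
    exact hv rfl⟩

end Configurations

/-- A consistent family of finite-volume measures `ρ_V^τ`, indexed by the finite sets of vertices
`V` and by the boundary conditions `τ` in a prescribed set `B` of configurations.
For `B = Ω⁺` this is an upwards specification, for `B = Ω⁺ ∪ Ω⁻` an upwards-downwards one. -/
structure Specification {𝕍 S : Type*} [MeasurableSpace S] (B : Set (𝕍 → S)) where
  /-- the probability measure `ρ_V^τ` -/
  law : Finset 𝕍 → B → ProbabilityMeasure (𝕍 → S)
  /-- `ρ_V^τ` is supported on `Ω_V^τ` -/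
  supported : ∀ V τ, (law V τ : Measure (𝕍 → S)) (agreeOff V τ.1)ᶜ = 0
  /-- `ρ_V^τ` only depends on the restriction of `τ` to the complement of `V` -/
  boundary : ∀ (V : Finset 𝕍) (τ τ' : B), (∀ v, v ∉ V → τ.1 v = τ'.1 v) → law V τ = law V τ'
  /-- `ρ_V^τ( · ∣ Ω_U^τ) = ρ_U^τ` whenever the event has positive probability -/
  consistent : ∀ (U V : Finset 𝕍), U ⊆ V → ∀ τ : B,
    (law V τ : Measure (𝕍 → S)) (agreeOff U τ.1) ≠ 0 →
      ProbabilityTheory.cond (law V τ : Measure (𝕍 → S)) (agreeOff U τ.1) = law U τ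

/-- Upwards specifications. -/
abbrev UpSpecification (𝕍 S : Type*) [MeasurableSpace S] [LE S] [OrderTop S] :=
  Specification (upConfigs 𝕍 S)

/-- Upwards-downwards specifications. -/
abbrev UpDownSpecification (𝕍 S : Type*) [MeasurableSpace S] [LE S] [OrderTop S] [OrderBot S] :=
  Specification (upConfigs 𝕍 S ∪ downConfigs 𝕍 S)

/-- `μ` is stochastically dominated by `ν`. -/
def StochLE {Ω : Type*} [MeasurableSpace Ω] [LE Ω] (μ ν : Measure Ω) : Prop :=
  ∀ A : Set Ω, IsUpperSet A → MeasurableSet A → μ A ≤ ν A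

namespace Specification

variable {𝕍 S : Type*} [MeasurableSpace S] {B : Set (𝕍 → S)}

/-- `Γ`-invariance: under `ρ_{γV}^{γτ}` the law of `γ⁻¹ω` is `ρ_V^τ`.
(The condition `γτ ∈ B` holds automatically for `B = Ω⁺` and `B = Ω⁺ ∪ Ω⁻`.) -/
def Invariant (Γ : Type*) [Group Γ] [MulAction Γ 𝕍] (ρ : Specification B) : Prop :=
  ∀ (γ : Γ) (V : Finset 𝕍) (τ : B) (h : shift γ τ.1 ∈ B),
    (ρ.law (smulFinset γ V) ⟨shift γ τ.1, h⟩ : Measure (𝕍 → S)).map (shift γ⁻¹) = ρ.law V τ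

/-- Monotonicity in the boundary condition. -/
def Monotonic [LE S] (ρ : Specification B) : Prop :=
  ∀ (V : Finset 𝕍) (τ τ' : B), τ.1 ≤ τ'.1 →
    StochLE (ρ.law V τ : Measure (𝕍 → S)) (ρ.law V τ' : Measure (𝕍 → S))

/-- The configurations of positive probability under `ρ_V^τ`. -/
def support (ρ : Specification B) (V : Finset 𝕍) (τ : B) : Set (𝕍 → S) :=
  {ω | (ρ.law V τ : Measure (𝕍 → S)) {ω} ≠ 0}

/-- Irreducibility with respect to the boundary condition `τ` (used for the all-maximal and the
all-minimal configuration): for every finite `V`, the set of configurations of positive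
`ρ_V^τ`-probability contains `τ` and is connected in the Hamming graph. -/
def IrreducibleAt (ρ : Specification B) (τ : B) : Prop :=
  ∀ V : Finset 𝕍, τ.1 ∈ ρ.support V τ ∧ ((hammingGraph 𝕍 S).induce (ρ.support V τ)).Connected

/-- `μ` is the weak limit of `ρ_V^τ` as `V ↑ 𝕍` along the finite sets ordered by inclusion. -/
def IsLimit [Countable 𝕍] [Countable S] [TopologicalSpace S] [DiscreteTopology S] [BorelSpace S]
    (ρ : Specification B) (τ : B) (μ : ProbabilityMeasure (𝕍 → S)) : Prop :=
  Tendsto (fun V : Finset 𝕍 => ρ.law V τ) atTop (𝓝 μ)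

end Specification

section Boundary

/-- The boundary condition `+` of an upwards specification. -/
def plus (𝕍 S : Type*) [LE S] [OrderTop S] : upConfigs 𝕍 S :=
  ⟨fun _ => ⊤, top_mem_upConfigs 𝕍 S⟩

/-- The boundary condition `+` of an upwards-downwards specification. -/
def udPlus (𝕍 S : Type*) [LE S] [OrderTop S] [OrderBot S] :
    (upConfigs 𝕍 S ∪ downConfigs 𝕍 S : Set (𝕍 → S)) :=
  ⟨fun _ => ⊤, Or.inl (top_mem_upConfigs 𝕍 S)⟩

/-- The boundary condition `-` of an upwards-downwards specification. -/
def udMinus (𝕍 S : Type*) [LE S] [OrderTop S] [OrderBot S] :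
    (upConfigs 𝕍 S ∪ downConfigs 𝕍 S : Set (𝕍 → S)) :=
  ⟨fun _ => ⊥, Or.inr (bot_mem_downConfigs 𝕍 S)⟩

end Boundary

/-- Total variation distance of two probability measures on a discrete space. -/
noncomputable def tvDist {S : Type*} [MeasurableSpace S] (μ ν : Measure S) : ℝ :=
  (1 / 2) * ∑' s : S, |μ.real {s} - ν.real {s}|

section Coding

variable {𝕍 S T : Type*} [MeasurableSpace S] [MeasurableSpace T]

/-- The law of an i.i.d. process `(Y_v)` with one-site marginal `ν`. -/
noncomputable def iidLaw (𝕍 : Type*) (ν : Measure T) : Measure (𝕍 → T) :=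
  Measure.infinitePi (fun _ : 𝕍 => ν)

/-- `φ` is a coding from the i.i.d. process with one-site marginal `ν` to a field of law `μ`:
it is measurable, maps the law of the process to `μ`, and commutes with the action of every
element of `Γ` on a `Γ`-invariant (measurable) set of full measure. -/
structure IsCoding (Γ : Type*) [Group Γ] [MulAction Γ 𝕍] (ν : Measure T)
    (φ : (𝕍 → T) → (𝕍 → S)) (μ : Measure (𝕍 → S)) : Prop where
  measurable : Measurable φ
  law : (iidLaw 𝕍 ν).map φ = μ
  equivariant : ∃ E : Set (𝕍 → T), MeasurableSet E ∧ iidLaw 𝕍 ν Eᶜ = 0 ∧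
    (∀ (γ : Γ) (y : 𝕍 → T), y ∈ E → shift γ y ∈ E) ∧
    ∀ (γ : Γ) (y : 𝕍 → T), y ∈ E → φ (shift γ y) = shift γ (φ y)

/-- `φ` is determined at distance `r` around `v` at the configuration `y`. -/
def DeterminedAt (G : SimpleGraph 𝕍) (φ : (𝕍 → T) → (𝕍 → S)) (v : 𝕍) (y : 𝕍 → T) (r : ℕ) : Prop :=
  ∀ y' : 𝕍 → T, (∀ w ∈ ballSet G v r, y w = y' w) → φ y v = φ y' v

/-- The coding radius `R_v(y)`: the minimal distance which determines `φ` at `v` and `y`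
(`⊤` if there is none). -/
noncomputable def codingRadius (G : SimpleGraph 𝕍) (φ : (𝕍 → T) → (𝕍 → S)) (v : 𝕍) (y : 𝕍 → T) :
    ℕ∞ :=
  ⨅ (r : ℕ) (_ : DeterminedAt G φ v y r), (r : ℕ∞)

/-- The coding radius is almost surely finite at every vertex. -/
def IsFinitary (G : SimpleGraph 𝕍) (ν : Measure T) (φ : (𝕍 → T) → (𝕍 → S)) : Prop :=
  ∀ v : 𝕍, ∀ᵐ y ∂(iidLaw 𝕍 ν), codingRadius G φ v y < ⊤

/-- A random field of law `μ` is a `Γ`-factor of an i.i.d. process (over a standard space). -/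
def IsFiid (Γ : Type*) [Group Γ] [MulAction Γ 𝕍] (μ : Measure (𝕍 → S)) : Prop :=
  ∃ (T : Type) (_ : MeasurableSpace T) (_ : StandardBorelSpace T)
    (ν : Measure T) (_ : IsProbabilityMeasure ν) (φ : (𝕍 → T) → (𝕍 → S)), IsCoding Γ ν φ μ

end Coding

end SpinSpec

open SpinSpec

set_option linter.unusedSectionVars false

/-! The proof is monotone coupling from the past. Every site carries i.i.d. uniform variables: a
label and a sequence of update variables. In a space-time box (a finite set `V` and the last `n`
times) the dynamics starts from `+` and performs `n` heat-bath sweeps of `V`, each visiting the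
sites in the order given by their labels. Single-site laws on a total order are realised by
quantiles of one uniform variable, so the updates are monotone in the state. Hence the state at time
zero decreases as the box grows: an update that only the larger box performs acts on a site where
the smaller dynamics still shows `+` (`IsHeatBath.run_antitone`).

For fixed `V`, the point mass at `+` is at most a constant times `ρ_V^+`, which every update
preserves; so this bound persists for all `n` (`map_run_le`). It gives tightness, so the antitone
sequence stabilises almost surely, and it makes the limit law absolutely continuous with respect to
`ρ_V^+`. The limit law is stationary for a sweep, and irreducibility identifies it with `ρ_V^+`
(`eq_of_stationary`). Convergence comes from monotonicity, so aperiodicity plays no role.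

If `μ⁺` is a probability measure, its one-site marginals give tightness along all boxes at once, so
the state stabilises jointly in `V` and `n` (`ae_boxState_eventually_eq`); for finite `S` this is
automatic. The limit has law `μ⁺` (`isLimit_map_limitState`). It commutes with `Γ` because it runs
over all boxes and, when the labels are distinct, the order of the updates depends on them alone
(`limitState_shift`).

For finite `S`, the dynamics started from `-` stays below. The limit at `v` is enclosed between the
two runs in a ball, which read only the variables of that ball; where they agree at `v`, the coding
radius is at most the radius of the ball (`determinedAt`). A union bound over the `|S| - 1`
thresholds above the minimum, followed by `n → ∞`, gives the total variation estimate. -/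

namespace SpinSpec

/-! ### Uniqueness of stationary laws of irreducible kernels -/

section Markov

variable {C : Type*} [MeasurableSpace C] [DiscreteMeasurableSpace C] [Countable C]

/-- A Markov kernel which is irreducible on the support of a stationary law `π` has no other
stationary law that is absolutely continuous with respect to `π`. -/
theorem eq_of_stationary {K : C → Measure C} [∀ x, IsProbabilityMeasure (K x)]
    {m π : Measure C} [IsProbabilityMeasure m] [IsProbabilityMeasure π]
    (hm : m.bind K = m) (hπ : π.bind K = π) (hac : m ≪ π)
    (hconn : ∀ x y, π {x} ≠ 0 → π {y} ≠ 0 →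
      Relation.ReflTransGen (fun a b => K a {b} ≠ 0) x y) : m = π := by
  have hK : Measurable K := .of_discrete
  set d := m - π with hd
  -- The difference of measures is truncated. The two halves of a Hahn decomposition are treated
  -- apart: `m ≤ π` on one, a genuine subtraction on the other.
  have hle : m ≤ d + π := by
    obtain ⟨s, hs⟩ := exists_isHahnDecomposition m π
    refine Measure.le_iff.2 fun A hA => ?_
    rw [← measure_inter_add_sdiff A hs.measurableSet,
      ← measure_inter_add_sdiff (μ := d + π) A hs.measurableSet]
    refine add_le_add ?_ ?_
    · have h1 : m (A ∩ s) ≤ π (A ∩ s) := by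
        have := hs.le_on A
        rwa [Measure.restrict_apply hA, Measure.restrict_apply hA] at this
      exact h1.trans (by simp)
    · have h2 := hs.ge_on_compl
      have h3 : d (A \ s) = m (A \ s) - π (A \ s) := by
        have : (d.restrict sᶜ) A = (m.restrict sᶜ) A - (π.restrict sᶜ) A := by
          rw [hd, Measure.restrict_sub_eq_restrict_sub_restrict hs.measurableSet.compl,
            Measure.sub_apply hA h2]
        simpa [Measure.restrict_apply hA, Set.sdiff_eq] using this
      rw [Measure.add_apply, h3]
      exact le_tsub_add
  have hdK : d ≤ d.bind K := by
    refine Measure.sub_le_of_le_add ?_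
    refine Measure.le_iff.2 fun A hA => ?_
    have h1 : m A = ∫⁻ x, K x A ∂m := by
      conv_lhs => rw [← hm]
      exact Measure.bind_apply hA hK.aemeasurable
    have h2 : π A = ∫⁻ x, K x A ∂π := by
      conv_lhs => rw [← hπ]
      exact Measure.bind_apply hA hK.aemeasurable
    rw [Measure.add_apply, h1, h2, Measure.bind_apply hA hK.aemeasurable,
      ← lintegral_add_measure]
    exact lintegral_mono' hle le_rfl
  -- `K` preserves total mass, so the inequality just obtained cannot be strict.
  have hdeq : d.bind K = d := by
    refine (Measure.eq_of_le_of_measure_univ_eq hdK ?_).symm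
    rw [Measure.bind_apply .univ hK.aemeasurable]
    simp
  have hstep : ∀ x y, d {x} ≠ 0 → K x {y} ≠ 0 → d {y} ≠ 0 := by
    intro x y hx hxy
    rw [← hdeq, Measure.bind_apply (measurableSet_singleton y) hK.aemeasurable]
    refine ne_of_gt (lt_of_lt_of_le ?_ (setLIntegral_le_lintegral {x} _))
    rw [lintegral_singleton]
    exact pos_iff_ne_zero.2 (mul_ne_zero hxy hx)
  have hsub : ∀ x, d {x} ≠ 0 → π {x} < m {x} := by
    intro x hx
    by_contra h
    push Not at h
    refine hx (Measure.sub_apply_eq_zero_of_restrict_le_restrict ?_ (measurableSet_singleton x))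
    rw [Measure.restrict_singleton, Measure.restrict_singleton]
    refine Measure.le_iff.2 fun A hA => ?_
    simp only [Measure.smul_apply, smul_eq_mul]
    gcongr
  -- The set charged by `d` is closed under transitions. If nonempty, it contains all atoms of `π`,
  -- so `m` exceeds `π` on each of them, although both have mass one.
  have hd0 : d = 0 := by
    by_contra hne
    obtain ⟨x, hx⟩ : ∃ x, d {x} ≠ 0 := by
      by_contra! h
      exact hne (Measure.ext_of_singleton fun x => by simp [h])
    have hπx : π {x} ≠ 0 := fun h => by
      have := hac h
      exact absurd (hsub x hx) (by simp [this])
    have hall : ∀ y, π {y} ≠ 0 → d {y} ≠ 0 := by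
      intro y hy
      have hxy := hconn x y hπx hy
      clear hy
      induction hxy with
      | refl => exact hx
      | tail _ h ih => exact hstep _ _ ih h
    have hle' : π ≤ m := by
      refine Measure.le_iff.2 fun A _ => ?_
      rw [← Measure.tsum_indicator_apply_singleton π A (.of_discrete),
        ← Measure.tsum_indicator_apply_singleton m A (.of_discrete)]
      refine ENNReal.tsum_le_tsum fun y => Set.indicator_le_indicator ?_
      by_cases hy : π {y} = 0
      · simp [hy]
      · exact (hsub y (hall y hy)).le
    have := Measure.eq_of_le_of_measure_univ_eq hle' (by simp)
    exact absurd (hsub x hx) (by rw [this]; exact lt_irrefl _)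
  rw [hd0, zero_add] at hle
  exact Measure.eq_of_le_of_measure_univ_eq hle (by simp)

end Markov

/-! ### Stabilisation of monotone nets -/

section Stabilise

variable {Ω S I : Type*} [MeasurableSpace Ω]

/-- An antitone family of random variables which is tight along a cofinal family of indices is
almost surely eventually constant. -/
theorem ae_exists_eventually_eq [Preorder I] [IsDirectedOrder I] [Nonempty I] [Countable I]
    [LinearOrder S] {P : Measure Ω} {X : I → Ω → S}
    (hX : ∀ ω, Antitone fun i => X i ω)
    (hF : ∀ ε : ENNReal, ε ≠ 0 → ∃ F : Finset S, ∀ i, ∃ j ≥ i, P {ω | X j ω ∉ F} ≤ ε) :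
    ∀ᵐ ω ∂P, ∃ s, ∀ᶠ i in atTop, X i ω = s := by
  rw [ae_iff]
  refine le_antisymm (ENNReal.le_of_forall_pos_le_add fun ε hε _ => ?_) zero_le
  obtain ⟨F, hF⟩ := hF ε (by simpa using hε.ne')
  set A : I → Set Ω := fun i => {ω | ∀ j ≥ i, X j ω ∉ F} with hA
  have hAmono : Monotone A := fun i i' h ω hω j hj => hω j (h.trans hj)
  have hsub : {ω | ¬ ∃ s, ∀ᶠ i in atTop, X i ω = s} ⊆ ⋃ i, A i := by
    intro ω hω
    by_contra h
    simp only [hA, Set.mem_iUnion, Set.mem_ofPred_eq, not_exists, not_forall, not_not] at h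
    refine hω ?_
    classical
    -- The least value of `F` ever taken is final: later values are no larger, and each is followed
    -- by a value in `F`, which is no smaller than this minimum.
    set F' := F.filter fun s => ∃ j, X j ω = s
    have hne : F'.Nonempty := by
      obtain ⟨j, _, hj⟩ := h (Classical.arbitrary I)
      exact ⟨X j ω, Finset.mem_filter.2 ⟨hj, j, rfl⟩⟩
    obtain ⟨s, hs, hmin⟩ := F'.exists_min_image id hne
    obtain ⟨hsF, j, hj⟩ := Finset.mem_filter.1 hs
    refine ⟨s, eventually_atTop.2 ⟨j, fun i hi => le_antisymm (hj ▸ hX ω hi) ?_⟩⟩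
    obtain ⟨k, hk, hkF⟩ := h i
    exact (hmin _ (Finset.mem_filter.2 ⟨hkF, k, rfl⟩)).trans (hX ω hk)
  calc P {ω | ¬ ∃ s, ∀ᶠ i in atTop, X i ω = s} ≤ P (⋃ i, A i) := measure_mono hsub
    _ = ⨆ i, P (A i) := (hAmono.directed_le).measure_iUnion
    _ ≤ 0 + ε := by
      rw [zero_add]
      refine iSup_le fun i => ?_
      obtain ⟨j, hj, hjF⟩ := hF i
      exact (measure_mono fun ω (hω : ∀ j ≥ i, X j ω ∉ F) => hω j hj).trans hjF

/-- A monotone family with values in a finite order is eventually constant. -/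
theorem _root_.Monotone.exists_eventually_eq_of_finite [Preorder I] [IsDirectedOrder I] [Nonempty I]
    [LinearOrder S] [Finite S] {x : I → S} (hx : Monotone x) : ∃ s, ∀ᶠ i in atTop, x i = s := by
  obtain ⟨_, ⟨j, rfl⟩, hmax⟩ := (Set.toFinite (Set.range x)).exists_maximalFor id _
    (Set.range_nonempty x)
  refine ⟨x j, eventually_atTop.2 ⟨j, fun i hi => le_antisymm (hmax ⟨i, rfl⟩ (hx hi)) (hx hi)⟩⟩

theorem _root_.Antitone.exists_eventually_eq_of_finite [Preorder I] [IsDirectedOrder I] [Nonempty I]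
    [LinearOrder S] [Finite S] {x : I → S} (hx : Antitone x) : ∃ s, ∀ᶠ i in atTop, x i = s :=
  Monotone.exists_eventually_eq_of_finite (S := Sᵒᵈ) (x := x) hx

open Classical in
/-- The eventual value of a net, or `d` if the net is not eventually constant. -/
noncomputable def eventualValue {C : Type*} [Preorder I] (d : C) (x : I → C) : C :=
  if h : ∃ s, ∀ᶠ i in atTop, x i = s then h.choose else d

theorem eventualValue_eq {C : Type*} [Preorder I] [IsDirectedOrder I] [Nonempty I] {d s : C}
    {x : I → C} (h : ∀ᶠ i in atTop, x i = s) : eventualValue d x = s := by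
  have h' : ∃ s, ∀ᶠ i in atTop, x i = s := ⟨s, h⟩
  rw [eventualValue, dif_pos h']
  obtain ⟨i, hi, hi'⟩ := (h.and h'.choose_spec).exists
  exact hi'.symm.trans hi

theorem eventually_eq_eventualValue {C : Type*} [Preorder I] (d : C)
    {x : I → C} (h : ∃ s, ∀ᶠ i in atTop, x i = s) : ∀ᶠ i in atTop, x i = eventualValue d x := by
  rw [eventualValue, dif_pos h]
  exact h.choose_spec

theorem measurable_eventualValue {C : Type*} [Preorder I] [IsDirectedOrder I] [Nonempty I]
    [Countable I] [MeasurableSpace C] [MeasurableSingletonClass C] [Countable C] (d : C)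
    {X : I → Ω → C} (hX : ∀ i, Measurable (X i)) :
    Measurable fun ω => eventualValue d fun i => X i ω := by
  have hev : ∀ s, MeasurableSet {ω | ∀ᶠ i in atTop, X i ω = s} := by
    intro s
    have : {ω | ∀ᶠ i in atTop, X i ω = s} = ⋃ i, ⋂ j, ⋂ (_ : i ≤ j), X j ⁻¹' {s} := by
      ext ω
      simp [eventually_atTop]
    rw [this]
    exact .iUnion fun i => .iInter fun j => .iInter fun _ => hX j (measurableSet_singleton s)
  refine measurable_to_countable' fun s => ?_
  have : (fun ω => eventualValue d fun i => X i ω) ⁻¹' {s} = {ω | ∀ᶠ i in atTop, X i ω = s} ∪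
      {ω | d = s} ∩ (⋃ r, {ω | ∀ᶠ i in atTop, X i ω = r})ᶜ := by
    ext ω
    simp only [Set.mem_preimage, Set.mem_singleton_iff, Set.mem_union, Set.mem_inter_iff,
      Set.mem_compl_iff, Set.mem_iUnion, Set.mem_ofPred_eq]
    by_cases h : ∃ r, ∀ᶠ i in atTop, X i ω = r
    · constructor
      · rintro rfl
        exact Or.inl (eventually_eq_eventualValue d h)
      · rintro (h' | h')
        · exact eventualValue_eq h'
        · exact absurd h h'.2
    · rw [eventualValue, dif_neg h]
      constructor
      · exact fun h' => Or.inr ⟨h', h⟩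
      · rintro (h' | h')
        · exact absurd ⟨s, h'⟩ h
        · exact h'.1
  rw [this]
  exact (hev s).union ((MeasurableSet.const _).inter (MeasurableSet.iUnion hev).compl)

end Stabilise

/-! ### Independence and composition of random maps -/

section Product

variable {J : Type*} {E : Type*} [MeasurableSpace E] {p : Measure E} [IsProbabilityMeasure p]

theorem measurable_splice (D : Set J) [DecidablePred (· ∈ D)] :
    Measurable (fun (q : (J → E) × (J → E)) j => if j ∈ D then q.1 j else q.2 j) := by
  refine measurable_pi_lambda _ fun j => ?_
  split_ifs <;> fun_prop

/-- Splicing two independent copies of an i.i.d. family along a set of indices. -/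
theorem infinitePi_prod_map_splice (D : Set J) [DecidablePred (· ∈ D)] :
    ((Measure.infinitePi fun _ : J => p).prod (Measure.infinitePi fun _ : J => p)).map
      (fun q j => if j ∈ D then q.1 j else q.2 j) = Measure.infinitePi fun _ : J => p := by
  classical
  refine Measure.eq_infinitePi _ fun s A hA => ?_
  rw [Measure.map_apply (measurable_splice D) (.pi s.countable_toSet fun j _ => hA j)]
  have : (fun (q : (J → E) × (J → E)) j => if j ∈ D then q.1 j else q.2 j) ⁻¹' (Set.pi s A) =
      (Set.pi (s.filter (· ∈ D)) A) ×ˢ (Set.pi (s.filter (· ∉ D)) A) := by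
    ext q
    simp only [Set.mem_preimage, Set.mem_pi, Set.mem_prod, Finset.mem_coe, Finset.mem_filter]
    constructor
    · intro h
      exact ⟨fun j hj => by simpa [hj.2] using h j hj.1, fun j hj => by simpa [hj.2] using h j hj.1⟩
    · rintro ⟨h1, h2⟩ j hj
      by_cases hD : j ∈ D
      · simpa [hD] using h1 j ⟨hj, hD⟩
      · simpa [hD] using h2 j ⟨hj, hD⟩
  rw [this, Measure.prod_prod, Measure.infinitePi_pi _ (fun j _ => hA j),
    Measure.infinitePi_pi _ (fun j _ => hA j), Finset.prod_filter_mul_prod_filter_not]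

variable {C : Type*} [MeasurableSpace C] [DiscreteMeasurableSpace C] [Countable C]

theorem measurable_foldr {Y : Type*} [MeasurableSpace Y] {f : J → Y → C → C}
    (hf : ∀ j c, Measurable fun y => f j y c) (l : List J) (c : C) :
    Measurable fun y => l.foldr (fun j => f j y) c := by
  induction l with
  | nil => exact measurable_const
  | cons j l ih =>
    have : Measurable fun q : Y × C => f j q.1 q.2 := measurable_from_prod_countable_left (hf j)
    exact this.comp (measurable_id.prodMk ih)

/-- The law of the composition of independent random maps. -/
theorem map_foldr_infinitePi {f : J → E → C → C} (hf : ∀ j c, Measurable fun u => f j u c)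
    {l : List J} (hl : l.Nodup) (c : C) :
    (Measure.infinitePi fun _ : J => p).map (fun y => l.foldr (fun j => f j (y j)) c) =
      l.foldr (fun j m => m.bind fun x => p.map fun u => f j u x) (Measure.dirac c) := by
  classical
  have hf' : ∀ j c, Measurable fun y : J → E => f j (y j) c :=
    fun j c => (hf j c).comp (measurable_pi_apply j)
  induction l with
  | nil => simp
  | cons j l ih =>
    obtain ⟨hjl, hl⟩ := List.nodup_cons.1 hl
    set Z := Measure.infinitePi fun _ : J => p with hZ
    have hW := measurable_foldr hf' l c
    simp only [List.foldr_cons]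
    rw [← ih hl]
    ext A hA
    have hm : Measurable fun y : J → E => f j (y j) (l.foldr (fun j => f j (y j)) c) :=
      measurable_foldr hf' (j :: l) c
    rw [Measure.map_apply hm hA, Measure.bind_apply hA (Measurable.of_discrete).aemeasurable,
      lintegral_map .of_discrete hW]
    -- As `j` does not occur in `l`, its coordinate may be taken from an independent copy; this
    -- separates the outer map from the state on which it acts.
    conv_lhs => rw [hZ, ← infinitePi_prod_map_splice (p := p) {j}]
    rw [Measure.map_apply (measurable_splice _) (hm hA),
      Measure.prod_apply_symm (measurable_splice _ (hm hA))]
    refine lintegral_congr fun y => ?_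
    have hj : p = Z.map (Function.eval j) := (Measure.infinitePi_map_eval (fun _ : J => p) j).symm
    rw [Measure.map_apply (hf j _) hA]
    conv_rhs => rw [hj]
    rw [Measure.map_apply (measurable_pi_apply j) (hf j _ hA)]
    congr 1
    ext z
    have : l.foldr (fun i => f i (if i ∈ ({j} : Set J) then z i else y i)) c =
        l.foldr (fun i => f i (y i)) c := by
      refine List.foldr_ext _ _ _ fun i hi _ => ?_
      rw [if_neg]
      rintro rfl
      exact hjl hi
    simp only [Set.mem_singleton_iff] at this
    simp only [Set.mem_preimage, Set.mem_singleton_iff, if_true, this]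

end Product

/-! ### Quantile coupling on a countable total order -/

section Quantile

/-- The uniform distribution on the unit interval. -/
noncomputable def unitLaw : Measure ℝ := volume.restrict (Set.Ico 0 1)

instance : IsProbabilityMeasure unitLaw := ⟨by simp [unitLaw]⟩

instance : NullSingletonClass unitLaw := by unfold unitLaw; infer_instance

variable {S : Type*} [LinearOrder S] [MeasurableSpace S]

/-- `s` is the quantile of `p` at level `u`. -/
def IsQuantile (p : Measure S) (u : ℝ) (s : S) : Prop :=
  p.real (Set.Iio s) ≤ u ∧ u < p.real (Set.Iic s)

/-- If `s' < s`, then `u` would lie both above `p (Iio s) ≥ p (Iic s')` and strictly below `p' (Iic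
s')`. The case `p = p'` gives uniqueness of quantiles. -/
theorem IsQuantile.le_of_le {p p' : Measure S} [IsFiniteMeasure p] {u : ℝ} {s s' : S}
    (hs : IsQuantile p u s) (hs' : IsQuantile p' u s')
    (h : p'.real (Set.Iic s') ≤ p.real (Set.Iic s')) : s ≤ s' := by
  by_contra! hlt
  have h1 : p.real (Set.Iic s') ≤ p.real (Set.Iio s) :=
    measureReal_mono fun x (hx : x ≤ s') => hx.trans_lt hlt
  linarith [hs.1, hs'.2]

theorem setOf_isQuantile (p : Measure S) (s : S) :
    {u | IsQuantile p u s} = Set.Ico (p.real (Set.Iio s)) (p.real (Set.Iic s)) := rfl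

variable [Countable S] [MeasurableSingletonClass S]

theorem unitLaw_isQuantile (p : Measure S) [IsProbabilityMeasure p] (s : S) :
    unitLaw {u | IsQuantile p u s} = p {s} := by
  have hadd : p.real (Set.Iic s) = p.real (Set.Iio s) + p.real {s} := by
    rw [← Set.Iio_union_right, measureReal_union (by simp) .of_discrete]
  rw [setOf_isQuantile, unitLaw, Measure.restrict_apply measurableSet_Ico,
    Set.inter_eq_left.2 (Set.Ico_subset_Ico measureReal_nonneg measureReal_le_one), Real.volume_Ico,
    hadd, add_sub_cancel_left, ofReal_measureReal]

/-- The intervals of levels belonging to different points are disjoint and have total length one.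
Levels can be missed: on the negative integers, level `0` has no quantile if every initial segment
is charged. -/
theorem ae_exists_isQuantile (p : Measure S) [IsProbabilityMeasure p] :
    ∀ᵐ u ∂unitLaw, ∃ s, IsQuantile p u s := by
  have hU : {u | ∃ s, IsQuantile p u s} = ⋃ s, {u | IsQuantile p u s} := by
    ext; simp
  have hmeas : ∀ s, MeasurableSet {u | IsQuantile p u s} := fun s => measurableSet_Ico
  have h1 : unitLaw {u | ∃ s, IsQuantile p u s} = 1 := by
    rw [hU, measure_iUnion _ hmeas]
    · simp_rw [unitLaw_isQuantile]
      have := Measure.tsum_indicator_apply_singleton p Set.univ .univ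
      simpa using this
    · intro s s' hss
      refine Set.disjoint_left.2 fun u hu hu' => hss (le_antisymm ?_ ?_)
      · exact hu.le_of_le hu' le_rfl
      · exact hu'.le_of_le hu le_rfl
  exact (prob_compl_eq_zero_iff (hU ▸ MeasurableSet.iUnion hmeas)).2 h1

/-- A countable family of laws on a countable linear order can be simultaneously realised by
random variables which respect stochastic domination surely. -/
theorem exists_monotone_realization {ι : Type*} [Countable ι] (p : ι → Measure S)
    [∀ i, IsProbabilityMeasure (p i)] :
    ∃ q : ι → ℝ → S, (∀ i, Measurable (q i)) ∧ (∀ i, unitLaw.map (q i) = p i) ∧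
      ∀ i j, (∀ s, p j (Set.Iic s) ≤ p i (Set.Iic s)) → ∀ u, q i u ≤ q j u := by
  have hae : ∀ᵐ u ∂unitLaw, ∀ i, ∃ s, IsQuantile (p i) u s :=
    ae_all_iff.2 fun i => ae_exists_isQuantile (p i)
  set A := {u | ∀ i, ∃ s, IsQuantile (p i) u s} with hA
  have hAm : MeasurableSet A := by
    simp only [hA, Set.ofPred_forall, Set.ofPred_exists]
    exact .iInter fun i => .iUnion fun s => measurableSet_Ico
  obtain ⟨u₀, hu₀⟩ : A.Nonempty := hae.exists
  classical
  -- The exceptional null set of levels is sent to one good level. The laws do not change, and the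
  -- comparison then holds for every `u`, as the pathwise arguments require.
  set g : ℝ → ℝ := A.piecewise id fun _ => u₀ with hg
  have hgm : Measurable g := measurable_id.piecewise hAm measurable_const
  have hgA : ∀ u, g u ∈ A := by
    intro u
    by_cases hu : u ∈ A
    · simp only [hg, Set.piecewise_eq_of_mem _ _ _ hu, id, hu]
    · simpa [hg, hu] using hu₀
  choose q hq using fun u i => hgA u i
  have hset : ∀ i s, (fun u => q u i) ⁻¹' {s} = g ⁻¹' {u | IsQuantile (p i) u s} := by
    intro i s
    ext u
    constructor
    · rintro rfl
      exact hq u i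
    · intro (hu : IsQuantile _ _ _)
      exact le_antisymm ((hq u i).le_of_le hu le_rfl) (hu.le_of_le (hq u i) le_rfl)
  have hqm : ∀ i, Measurable fun u => q u i := fun i =>
    measurable_to_countable' fun s => by
      rw [hset]; exact hgm measurableSet_Ico
  refine ⟨fun i u => q u i, hqm, fun i => ?_, fun i j hij u => ?_⟩
  · refine Measure.ext_of_singleton fun s => ?_
    rw [Measure.map_apply (hqm i) (measurableSet_singleton s), hset, ← unitLaw_isQuantile]
    refine measure_congr ?_
    filter_upwards [hae] with u hu
    have : u ∈ A := hu
    exact congrArg (IsQuantile (p i) · s) (by simp [hg, this])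
  · refine (hq u i).le_of_le (hq u j) ?_
    exact ENNReal.toReal_mono (measure_ne_top _ _) (hij _)

end Quantile

/-- The closure properties shared by `Ω⁺` and `Ω⁺ ∪ Ω⁻`. -/
structure IsBoundarySet (Γ : Type*) {𝕍 S : Type*} [Group Γ] [MulAction Γ 𝕍]
    (B : Set (𝕍 → S)) : Prop where
  countable : B.Countable
  agreeOff_subset : ∀ τ ∈ B, ∀ V, agreeOff V τ ⊆ B
  shift_mem : ∀ (γ : Γ), ∀ τ ∈ B, shift γ τ ∈ B

/-! ### Admissible boundary conditions -/

section Closure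

variable {Γ 𝕍 S : Type*} [Group Γ] [MulAction Γ 𝕍]

theorem agreeOff_countable [Countable S] (V : Finset 𝕍) (τ : 𝕍 → S) : (agreeOff V τ).Countable := by
  refine Set.MapsTo.countable_of_injOn (f := fun (ω : 𝕍 → S) (v : V) => ω v) (t := Set.univ)
    (fun _ _ => Set.mem_univ _) ?_ Set.countable_univ
  intro ω hω ω' hω' h
  funext v
  by_cases hv : v ∈ V
  · exact congrFun h ⟨v, hv⟩
  · rw [hω v hv, hω' v hv]

theorem isBoundarySet_iUnion_agreeOff [Countable 𝕍] [Countable S] (a : S) :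
    IsBoundarySet Γ (⋃ V : Finset 𝕍, agreeOff V (fun _ => a)) where
  countable := Set.countable_iUnion fun V => agreeOff_countable V _
  agreeOff_subset τ hτ V ω hω := by
    classical
    obtain ⟨W, hW⟩ := Set.mem_iUnion.1 hτ
    refine Set.mem_iUnion.2 ⟨V ∪ W, fun v hv => ?_⟩
    rw [Finset.mem_union, not_or] at hv
    rw [hω v hv.1, hW v hv.2]
  shift_mem γ τ hτ := by
    obtain ⟨W, hW⟩ := Set.mem_iUnion.1 hτ
    refine Set.mem_iUnion.2 ⟨smulFinset γ W, fun v hv => hW _ fun h => hv ?_⟩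
    exact Finset.mem_map.2 ⟨_, h, by simp⟩

theorem IsBoundarySet.union {B B' : Set (𝕍 → S)} (h : IsBoundarySet Γ B)
    (h' : IsBoundarySet Γ B') : IsBoundarySet Γ (B ∪ B') where
  countable := h.countable.union h'.countable
  agreeOff_subset τ hτ V := hτ.elim
    (fun hτ => (h.agreeOff_subset τ hτ V).trans Set.subset_union_left)
    (fun hτ => (h'.agreeOff_subset τ hτ V).trans Set.subset_union_right)
  shift_mem γ τ hτ := hτ.imp (h.shift_mem γ τ) (h'.shift_mem γ τ)

theorem mem_smulFinset {γ : Γ} {V : Finset 𝕍} {v : 𝕍} : γ • v ∈ smulFinset γ V ↔ v ∈ V := by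
  simp [smulFinset]

theorem smulFinset_singleton (γ : Γ) (v : 𝕍) : smulFinset γ {v} = {γ • v} := by
  simp [smulFinset]

@[simp] theorem shift_smul (γ : Γ) (ω : 𝕍 → S) (v : 𝕍) : shift γ ω (γ • v) = ω v := by
  simp [shift]

theorem measurable_shift [MeasurableSpace S] (γ : Γ) : Measurable (shift γ : (𝕍 → S) → 𝕍 → S) :=
  measurable_pi_lambda _ fun _ => measurable_pi_apply _

end Closure

/-! ### Single-site resampling and the heat bath -/

section SingleSite

variable {Γ 𝕍 S : Type*} [Group Γ] [MulAction Γ 𝕍] [Countable 𝕍] [Countable S]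
  [MeasurableSpace S] [MeasurableSingletonClass S] {B : Set (𝕍 → S)} [Countable B]

theorem measurableEmbedding_val : MeasurableEmbedding (Subtype.val : B → 𝕍 → S) :=
  .subtype_coe (Set.to_countable B).measurableSet

namespace Specification

/-- The law `ρ_V^τ` as a measure on the countable set of boundary conditions. -/
noncomputable def stateLaw (ρ : Specification B) (V : Finset 𝕍) (τ : B) : Measure B :=
  (ρ.law V τ : Measure (𝕍 → S)).comap Subtype.val

variable (ρ : Specification B) (V : Finset 𝕍) (τ : B)

theorem stateLaw_apply (A : Set B) :
    ρ.stateLaw V τ A = (ρ.law V τ : Measure (𝕍 → S)) (Subtype.val '' A) :=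
  measurableEmbedding_val.comap_apply _ _

theorem stateLaw_singleton (x : B) :
    ρ.stateLaw V τ {x} = (ρ.law V τ : Measure (𝕍 → S)) {x.1} := by
  rw [stateLaw_apply, Set.image_singleton]

theorem ae_mem_agreeOff : ∀ᵐ ω ∂(ρ.law V τ : Measure (𝕍 → S)), ω ∈ agreeOff V τ.1 :=
  ρ.supported V τ

theorem map_val_stateLaw (hB : ∀ τ ∈ B, ∀ V, agreeOff V τ ⊆ B) :
    (ρ.stateLaw V τ).map Subtype.val = (ρ.law V τ : Measure (𝕍 → S)) := by
  rw [stateLaw, measurableEmbedding_val.map_comap, Subtype.range_coe,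
    Measure.restrict_eq_self_of_ae_mem]
  filter_upwards [ρ.ae_mem_agreeOff V τ] with ω hω using hB _ τ.2 V hω

theorem isProbabilityMeasure_stateLaw (hB : ∀ τ ∈ B, ∀ V, agreeOff V τ ⊆ B) :
    IsProbabilityMeasure (ρ.stateLaw V τ) := by
  have h := ρ.map_val_stateLaw V τ hB
  constructor
  rw [← Set.preimage_univ (f := (Subtype.val : B → 𝕍 → S)),
    ← Measure.map_apply measurableEmbedding_val.measurable .univ, h, measure_univ]

variable {ρ V τ}

theorem mem_agreeOff_of_stateLaw_ne_zero {x : B} (hx : ρ.stateLaw V τ {x} ≠ 0) :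
    x.1 ∈ agreeOff V τ.1 := by
  by_contra h
  rw [stateLaw_singleton] at hx
  exact hx (measure_mono_null (Set.singleton_subset_iff.2 h) (ρ.supported V τ))

theorem law_congr {x y : B} (h : x.1 ∈ agreeOff V y.1) : ρ.law V x = ρ.law V y :=
  ρ.boundary V x y h

theorem stateLaw_congr {x y : B} (h : x.1 ∈ agreeOff V y.1) : ρ.stateLaw V x = ρ.stateLaw V y := by
  rw [stateLaw, law_congr h, stateLaw]

theorem mem_agreeOff_comm {x y : 𝕍 → S} : x ∈ agreeOff V y ↔ y ∈ agreeOff V x :=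
  ⟨fun h v hv => (h v hv).symm, fun h v hv => (h v hv).symm⟩

theorem measurableSet_agreeOff (τ : 𝕍 → S) : MeasurableSet (agreeOff V τ) :=
  (agreeOff_countable V τ).measurableSet

/-- The finite-volume conditional probabilities: `ρ_V^τ(x) = ρ_V^τ(Ω_v^x) ρ_v^x(x)`. -/
theorem stateLaw_eq_mul {v : 𝕍} (hv : v ∈ V) (x y : B) (hxy : y.1 ∈ agreeOff {v} x.1) :
    ρ.stateLaw V τ {y} =
      (ρ.law V τ : Measure (𝕍 → S)) (agreeOff {v} x.1) * ρ.stateLaw {v} x {y} := by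
  rcases eq_or_ne ((ρ.law V τ : Measure (𝕍 → S)) (agreeOff {v} x.1)) 0 with h0 | h0
  · rw [h0, zero_mul, stateLaw_singleton]
    exact measure_mono_null (Set.singleton_subset_iff.2 hxy) h0
  have hx : x.1 ∈ agreeOff V τ.1 := by
    obtain ⟨z, hz, hz'⟩ : ∃ z, z ∈ agreeOff {v} x.1 ∧ z ∈ agreeOff V τ.1 := by
      by_contra! h
      exact h0 (measure_mono_null (fun z hz => h z hz) (ρ.supported V τ))
    intro w hw
    rw [← hz' w hw, hz w]
    simp only [Finset.mem_singleton]
    rintro rfl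
    exact hw hv
  have hc := ρ.consistent {v} V (Finset.singleton_subset_iff.2 hv) x
  rw [law_congr hx] at hc
  rw [stateLaw_singleton, stateLaw_singleton, ← hc h0,
    cond_apply (measurableSet_agreeOff _), ← mul_assoc,
    ENNReal.mul_inv_cancel h0 (measure_ne_top _ _), one_mul,
    Set.inter_eq_right.2 (Set.singleton_subset_iff.2 hxy)]

/-- Resampling a single site preserves the finite-volume law. -/
theorem bind_stateLaw (hB : ∀ τ ∈ B, ∀ V, agreeOff V τ ⊆ B) {v : 𝕍} (hv : v ∈ V) :
    (ρ.stateLaw V τ).bind (ρ.stateLaw {v}) = ρ.stateLaw V τ := by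
  refine Measure.ext_of_singleton fun y => ?_
  rw [Measure.bind_apply (measurableSet_singleton y) (Measurable.of_discrete).aemeasurable]
  have hA : MeasurableSet {x : B | x.1 ∈ agreeOff {v} y.1} := .of_discrete
  -- The probability of resampling to `y` vanishes unless the state agrees with `y` off `v`, and is
  -- constant on that class.
  have hf : ∀ x : B, ρ.stateLaw {v} x {y} =
      Set.indicator {x : B | x.1 ∈ agreeOff {v} y.1} (fun _ => ρ.stateLaw {v} y {y}) x := by
    intro x
    by_cases hx : x.1 ∈ agreeOff {v} y.1
    · rw [Set.indicator_of_mem (by exact hx), stateLaw_congr hx]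
    · rw [Set.indicator_of_notMem (by exact hx)]
      by_contra h
      exact hx (mem_agreeOff_comm.1 (mem_agreeOff_of_stateLaw_ne_zero h))
  rw [lintegral_congr hf, lintegral_indicator_const hA, mul_comm,
    stateLaw_eq_mul hv y y fun _ _ => rfl,
    stateLaw_apply]
  congr 2
  ext ω
  constructor
  · rintro ⟨x, hx, rfl⟩
    exact hx
  · exact fun h => ⟨⟨ω, hB y.1 y.2 {v} h⟩, h, rfl⟩

theorem stateLaw_self_ne_zero {v : 𝕍} (hv : v ∈ V) {x y : B} (hxy : y.1 ∈ agreeOff {v} x.1)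
    (hy : ρ.stateLaw V τ {y} ≠ 0) : ρ.stateLaw {v} x {y} ≠ 0 := by
  rw [stateLaw_eq_mul hv x y hxy] at hy
  exact right_ne_zero_of_mul hy

end Specification

/-- A single-site heat-bath dynamics driven by uniform variables. -/
structure IsHeatBath (Γ : Type*) [Group Γ] [MulAction Γ 𝕍] [LE S] (ρ : Specification B)
    (f : 𝕍 → ℝ → B → B) : Prop where
  apply_ne : ∀ v u x w, w ≠ v → (f v u x).1 w = x.1 w
  measurable : ∀ v x, Measurable fun u => f v u x
  law : ∀ v x, unitLaw.map (fun u => f v u x) = ρ.stateLaw {v} x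
  mono : ∀ v u x y, x.1 ≤ y.1 → (f v u x).1 ≤ (f v u y).1
  equivariant : ∀ (γ : Γ) v u x y, y.1 = shift γ x.1 → (f (γ • v) u y).1 = shift γ (f v u x).1

/-- Monotonicity of the specification, tested on the upper sets `{ω | s < ω v}`, orders the
distribution functions of the single-site laws. All of them are realised from one uniform variable,
and equal laws give equal variables; so invariance in law becomes equivariance with the same `u`. -/
theorem Specification.Monotonic.exists_isHeatBath [LinearOrder S] (hB : IsBoundarySet Γ B)
    {ρ : Specification B} (hmono : ρ.Monotonic) (hinv : ρ.Invariant Γ) :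
    ∃ f, IsHeatBath Γ ρ f := by
  classical
  have hev : ∀ v : 𝕍, Measurable fun ω : 𝕍 → S => ω v := fun v => measurable_pi_apply v
  set p : 𝕍 × B → Measure S := fun i => (ρ.law {i.1} i.2 : Measure (𝕍 → S)).map fun ω => ω i.1
    with hp
  have : ∀ i, IsProbabilityMeasure (p i) := fun i =>
    Measure.isProbabilityMeasure_map (hev _).aemeasurable
  obtain ⟨q, hqm, hql, hq⟩ := exists_monotone_realization p
  have hq' : ∀ i j, p i = p j → ∀ u, q i u = q j u := fun i j h u =>
    le_antisymm (hq i j (fun s => by rw [h]) u) (hq j i (fun s => by rw [h]) u)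
  have hpmono : ∀ v (x y : B), x.1 ≤ y.1 → ∀ s, p (v, y) (Set.Iic s) ≤ p (v, x) (Set.Iic s) := by
    intro v x y hxy s
    have h := hmono {v} x y hxy {ω | s < ω v} (fun ω ω' h hω => lt_of_lt_of_le hω (h v))
      ((hev v) (t := Set.Ioi s) .of_discrete)
    have key : ∀ z : B, p (v, z) (Set.Iic s) =
        1 - (ρ.law {v} z : Measure (𝕍 → S)) {ω | s < ω v} := by
      intro z
      rw [← Set.compl_Ioi, prob_compl_eq_one_sub .of_discrete]
      simp only [hp]
      rw [Measure.map_apply (hev v) .of_discrete]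
      rfl
    rw [key, key]
    exact tsub_le_tsub_left h 1
  have hmem : ∀ v u (x : B), Function.update x.1 v (q (v, x) u) ∈ B := fun v u x =>
    hB.agreeOff_subset x.1 x.2 {v} fun w hw => by
      rw [Function.update_of_ne (by simpa using hw)]
  refine ⟨fun v u x => ⟨_, hmem v u x⟩, ⟨fun v u x w hw => Function.update_of_ne hw _ _,
    fun v x => ?_, fun v x => ?_, fun v u x y hxy => ?_, fun γ v u x y hxy => ?_⟩⟩
  · refine Measurable.subtype_mk (measurable_pi_lambda _ fun w => ?_)
    rcases eq_or_ne w v with rfl | hw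
    · simpa using hqm (w, x)
    · simp [Function.update_of_ne hw]
  · refine Measure.ext_of_singleton fun y => ?_
    have hqx : Measurable (q (v, x)) := hqm (v, x)
    have hfm : Measurable fun u => (⟨Function.update x.1 v (q (v, x) u), hmem v u x⟩ : B) := by
      refine Measurable.subtype_mk (measurable_pi_lambda _ fun w => ?_)
      rcases eq_or_ne w v with rfl | hw
      · simpa using hqm (w, x)
      · simp [Function.update_of_ne hw]
    rw [Measure.map_apply hfm (measurableSet_singleton y)]
    by_cases hy : y.1 ∈ agreeOff {v} x.1
    · have h1 : (fun u => (⟨Function.update x.1 v (q (v, x) u), hmem v u x⟩ : B)) ⁻¹' {y} =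
          q (v, x) ⁻¹' {y.1 v} := by
        ext u
        simp only [Set.mem_preimage, Set.mem_singleton_iff, Subtype.ext_iff]
        constructor
        · intro h
          rw [← h, Function.update_self]
        · intro h
          funext w
          rcases eq_or_ne w v with rfl | hw
          · rw [← h, Function.update_self]
          · rw [Function.update_of_ne hw, hy w (by simpa using hw)]
      rw [h1, ← Measure.map_apply hqx (measurableSet_singleton _), hql,
        Measure.map_apply (hev v) (measurableSet_singleton _), ρ.stateLaw_singleton]
      refine measure_congr ?_
      filter_upwards [ρ.ae_mem_agreeOff {v} x] with ω hω
      refine propext ⟨fun (h : ω v = y.1 v) => ?_, fun (h : ω = y.1) => congrFun h v⟩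
      funext w
      rcases eq_or_ne w v with rfl | hw
      · exact h
      · rw [hω w (by simpa using hw), hy w (by simpa using hw)]
    · have h1 : (fun u => (⟨Function.update x.1 v (q (v, x) u), hmem v u x⟩ : B)) ⁻¹' {y} = ∅ := by
        refine Set.eq_empty_of_forall_notMem fun u hu => hy ?_
        rw [← (show _ = y from hu)]
        exact fun w hw => Function.update_of_ne (by simpa using hw) _ _
      rw [h1, measure_empty]
      by_contra h
      exact hy (Specification.mem_agreeOff_of_stateLaw_ne_zero (Ne.symm h))
  · intro w
    rcases eq_or_ne w v with rfl | hw
    · simpa using hq _ _ (hpmono w x y hxy) u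
    · simpa [Function.update_of_ne hw] using hxy w
  · have hpe : p (γ • v, y) = p (v, x) := by
      have h := hinv γ {v} x (hB.shift_mem γ x.1 x.2)
      have hy : (⟨shift γ x.1, hB.shift_mem γ x.1 x.2⟩ : B) = y := Subtype.ext hxy.symm
      rw [smulFinset_singleton, hy] at h
      simp only [hp]
      rw [← h, Measure.map_map (hev v) (measurable_shift _)]
      congr 1
      funext ω
      simp [shift]
    funext w
    obtain ⟨w, rfl⟩ := MulAction.surjective γ w
    change Function.update y.1 (γ • v) _ (γ • w) = shift γ (Function.update x.1 v _) (γ • w)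
    rw [shift_smul]
    rcases eq_or_ne w v with rfl | hw
    · simpa using hq' _ _ hpe u
    · rw [Function.update_of_ne (by simpa using hw), Function.update_of_ne hw, hxy, shift_smul]

end SingleSite

/-! ### The order of the updates -/

section Schedule

variable {𝕍 : Type*} [Countable 𝕍]

/-- An arbitrary enumeration of the sites, used to break ties between labels. -/
noncomputable def siteIndex (𝕍 : Type*) [Countable 𝕍] : 𝕍 → ℕ := (exists_injective_nat 𝕍).choose

theorem siteIndex_injective : Function.Injective (siteIndex 𝕍) :=
  (exists_injective_nat 𝕍).choose_spec

/-- Updates are ordered by their (backward) time, and within a sweep by the labels of the sites. -/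
noncomputable def updateKey (t : 𝕍 → ℝ) (j : 𝕍 × ℕ) : ℕ ×ₗ (ℝ ×ₗ ℕ) :=
  toLex (j.2, toLex (t j.1, siteIndex 𝕍 j.1))

theorem updateKey_injective (t : 𝕍 → ℝ) : Function.Injective (updateKey t) := by
  intro i j h
  simp only [updateKey, EmbeddingLike.apply_eq_iff_eq, Prod.mk.injEq] at h
  exact Prod.ext (siteIndex_injective h.2.2) h.1

/-- The update `i` comes after the update `j` in the dynamics (or `i = j`). -/
def UpdateLE (t : 𝕍 → ℝ) (i j : 𝕍 × ℕ) : Prop := updateKey t i ≤ updateKey t j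

noncomputable instance (t : 𝕍 → ℝ) : DecidableRel (UpdateLE t) := fun _ _ => Classical.dec _

instance (t : 𝕍 → ℝ) : IsTrans (𝕍 × ℕ) (UpdateLE t) := ⟨fun _ _ _ h h' => le_trans h h'⟩

instance (t : 𝕍 → ℝ) : Std.Antisymm (UpdateLE t) :=
  ⟨fun _ _ h h' => updateKey_injective t (le_antisymm h h')⟩

instance (t : 𝕍 → ℝ) : Std.Total (UpdateLE t) := ⟨fun _ _ => le_total _ _⟩

theorem updateLE_iff {t : 𝕍 → ℝ} {i j : 𝕍 × ℕ} : UpdateLE t i j ↔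
    i.2 < j.2 ∨ i.2 = j.2 ∧
      (t i.1 < t j.1 ∨ t i.1 = t j.1 ∧ siteIndex 𝕍 i.1 ≤ siteIndex 𝕍 j.1) := by
  simp [UpdateLE, updateKey, Prod.Lex.le_iff]

theorem UpdateLE.time_le {t : 𝕍 → ℝ} {i j : 𝕍 × ℕ} (h : UpdateLE t i j) : i.2 ≤ j.2 := by
  rcases updateLE_iff.1 h with h | h
  exacts [h.le, h.1.le]

/-- The updates in `D`, the last one first. -/
noncomputable def schedule (t : 𝕍 → ℝ) (D : Finset (𝕍 × ℕ)) : List (𝕍 × ℕ) := D.sort (UpdateLE t)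

theorem mem_schedule {t : 𝕍 → ℝ} {D : Finset (𝕍 × ℕ)} {j : 𝕍 × ℕ} : j ∈ schedule t D ↔ j ∈ D :=
  Finset.mem_sort _

theorem nodup_schedule (t : 𝕍 → ℝ) (D : Finset (𝕍 × ℕ)) : (schedule t D).Nodup :=
  Finset.sort_nodup _ _

theorem pairwise_schedule (t : 𝕍 → ℝ) (D : Finset (𝕍 × ℕ)) :
    (schedule t D).Pairwise (UpdateLE t) :=
  Finset.pairwise_sort _ _

theorem eq_schedule {t : 𝕍 → ℝ} {D : Finset (𝕍 × ℕ)} {l : List (𝕍 × ℕ)} (hl : l.Nodup)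
    (hmem : ∀ j, j ∈ l ↔ j ∈ D) (hp : l.Pairwise (UpdateLE t)) : l = schedule t D :=
  ((List.perm_ext_iff_of_nodup hl (nodup_schedule t D)).2 fun j =>
    (hmem j).trans mem_schedule.symm).eq_of_pairwise
      (fun _ _ _ _ h h' => Std.Antisymm.antisymm _ _ h h') hp (pairwise_schedule t D)

-- Allows the runs in two boxes to be followed along one common list, each skipping the updates
-- outside its own box.
open Classical in
theorem filter_schedule (t : 𝕍 → ℝ) {D D' : Finset (𝕍 × ℕ)} (h : D ⊆ D') :
    (schedule t D').filter (· ∈ D) = schedule t D :=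
  eq_schedule ((nodup_schedule t D').filter _)
    (fun j => by simpa [mem_schedule] using fun hj => h hj) ((pairwise_schedule t D').filter _)

theorem schedule_congr {t t' : 𝕍 → ℝ} {D : Finset (𝕍 × ℕ)} (h : ∀ j ∈ D, t j.1 = t' j.1) :
    schedule t D = schedule t' D := by
  refine eq_schedule (nodup_schedule t D) (fun _ => mem_schedule) ?_
  refine (pairwise_schedule t D).imp_of_mem fun {i j} hi hj hij => ?_
  rw [mem_schedule] at hi hj
  simpa [updateLE_iff, h i hi, h j hj] using hij

/-- The updates of the sites of `V` at the last `n` times. -/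
def box (V : Finset 𝕍) (n : ℕ) : Finset (𝕍 × ℕ) := V ×ˢ Finset.range n

theorem mem_box {V : Finset 𝕍} {n : ℕ} {j : 𝕍 × ℕ} : j ∈ box V n ↔ j.1 ∈ V ∧ j.2 < n := by
  simp [box]

/-- The labels do not depend on time, so all sweeps visit `V` in the same order and the dynamics is
a time-homogeneous chain. The head of the list is the sweep performed last. -/
theorem schedule_box_succ (t : 𝕍 → ℝ) (V : Finset 𝕍) (n : ℕ) :
    schedule t (box V (n + 1)) =
      schedule t (box V 1) ++ (schedule t (box V n)).map (Prod.map id (· + 1)) := by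
  refine (eq_schedule ?_ (fun j => ?_) ?_).symm
  · refine List.Nodup.append (nodup_schedule _ _)
      ((nodup_schedule _ _).map (Function.injective_id.prodMap (add_left_injective 1))) ?_
    intro j hj hj'
    obtain ⟨i, _, rfl⟩ := List.mem_map.1 hj'
    simpa using (mem_box.1 (mem_schedule.1 hj)).2
  · obtain ⟨v, k⟩ := j
    simp only [List.mem_append, List.mem_map, mem_schedule, mem_box, Prod.exists, Prod.map, id,
      Prod.mk.injEq]
    constructor
    · rintro (h | ⟨w, m, h, rfl, rfl⟩)
      · exact ⟨h.1, by omega⟩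
      · exact ⟨h.1, by omega⟩
    · rintro ⟨hv, hk⟩
      rcases k with _ | k
      · exact Or.inl ⟨hv, Nat.one_pos⟩
      · exact Or.inr ⟨v, k, ⟨hv, by omega⟩, rfl, rfl⟩
  · refine List.pairwise_append.2 ⟨pairwise_schedule _ _, ?_, ?_⟩
    · refine List.pairwise_map.2 ((pairwise_schedule _ _).imp fun h => ?_)
      simpa [updateLE_iff] using updateLE_iff.1 h
    · intro i hi j hj
      obtain ⟨j, _, rfl⟩ := List.mem_map.1 hj
      have := (mem_box.1 (mem_schedule.1 hi)).2
      exact updateLE_iff.2 (Or.inl (by simp; omega))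

theorem map_fst_schedule_box_succ (t : 𝕍 → ℝ) (V : Finset 𝕍) (n : ℕ) :
    (schedule t (box V (n + 1))).map Prod.fst =
      (schedule t (box V 1)).map Prod.fst ++ (schedule t (box V n)).map Prod.fst := by
  rw [schedule_box_succ, List.map_append, List.map_map]
  rfl

/-- The tie-break `siteIndex` need not respect `Γ`; for injective labels it never compares two
different sites. -/
theorem schedule_smul {Γ : Type*} [Group Γ] [MulAction Γ 𝕍] {t : 𝕍 → ℝ} (ht : Function.Injective t)
    (γ : Γ) (V : Finset 𝕍) (n : ℕ) :
    schedule (shift γ t) (box (smulFinset γ V) n) =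
      (schedule t (box V n)).map (Prod.map (γ • ·) id) := by
  refine (eq_schedule ?_ (fun j => ?_) ?_).symm
  · exact (nodup_schedule _ _).map ((MulAction.injective γ).prodMap Function.injective_id)
  · obtain ⟨v, k⟩ := j
    obtain ⟨v, rfl⟩ := MulAction.surjective γ v
    simp [mem_schedule, mem_box, mem_smulFinset]
  · refine List.pairwise_map.2 ((pairwise_schedule _ _).imp fun {i j} h => ?_)
    rw [updateLE_iff] at h ⊢
    simp only [Prod.map_fst, Prod.map_snd, shift_smul, id]
    refine h.imp_right (And.imp_right (Or.imp_right ?_))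
    rintro ⟨h, -⟩
    exact ⟨h, by rw [ht h]⟩

end Schedule

/-! ### Monotonicity of the dynamics in the space-time box -/

section Run

variable {Γ 𝕍 S : Type*} [Group Γ] [MulAction Γ 𝕍] [Countable 𝕍] [Countable S]
  [MeasurableSpace S] [MeasurableSingletonClass S] {B : Set (𝕍 → S)} [Countable B]

/-- The state at time zero of the dynamics started from `τ` which performs the updates of the sites
of `V` at the last `n` times, with labels `t` and update variables `u`. -/
noncomputable def run (f : 𝕍 → ℝ → B → B) (τ : B) (V : Finset 𝕍) (n : ℕ) (t : 𝕍 → ℝ)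
    (u : 𝕍 × ℕ → ℝ) : B :=
  (schedule t (box V n)).foldr (fun j => f j.1 (u j)) τ

theorem run_congr (f : 𝕍 → ℝ → B → B) (τ : B) {V : Finset 𝕍} {n : ℕ} {t t' : 𝕍 → ℝ}
    {u u' : 𝕍 × ℕ → ℝ} (ht : ∀ v ∈ V, t v = t' v) (hu : ∀ j : 𝕍 × ℕ, j.1 ∈ V → u j = u' j) :
    run f τ V n t u = run f τ V n t' u' := by
  rw [run, run, schedule_congr fun j hj => ht _ (mem_box.1 hj).1]
  refine List.foldr_ext _ _ _ fun _ hj _ => ?_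
  rw [hu _ (mem_box.1 (mem_schedule.1 hj)).1]

variable [LinearOrder S] {ρ : Specification B} {f : 𝕍 → ℝ → B → B}

namespace IsHeatBath

variable (hf : IsHeatBath Γ ρ f)
include hf

theorem foldr_apply_of_notMem (l : List (𝕍 × ℕ)) (u : 𝕍 × ℕ → ℝ) (τ : B) (v : 𝕍)
    (hv : ∀ j ∈ l, j.1 ≠ v) : (l.foldr (fun j => f j.1 (u j)) τ).1 v = τ.1 v := by
  induction l with
  | nil => rfl
  | cons j l ih =>
    rw [List.foldr_cons, hf.apply_ne _ _ _ _ (hv j List.mem_cons_self).symm,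
      ih fun i hi => hv i (List.mem_cons_of_mem _ hi)]

theorem run_mem_agreeOff (τ : B) (V : Finset 𝕍) (n : ℕ) (t : 𝕍 → ℝ) (u : 𝕍 × ℕ → ℝ) :
    (run f τ V n t u).1 ∈ agreeOff V τ.1 := fun v hv =>
  hf.foldr_apply_of_notMem _ u τ v fun _ hj h =>
    hv (h ▸ (mem_box.1 (mem_schedule.1 hj)).1)

-- By `hD` and `hD'`, a set containing an update contains all later updates of the same site
-- (smaller index means later). So when one run skips an update, it has not touched that site
-- before, and the site still has its initial value, which is extremal by `htop` or `hbot`.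
open Classical in
theorem foldr_filter_le {l : List (𝕍 × ℕ)} (hl : l.Pairwise fun i j => i.2 ≤ j.2)
    {D D' : Finset (𝕍 × ℕ)} (hD : ∀ v k k', k' ≤ k → (v, k) ∈ D → (v, k') ∈ D)
    (hD' : ∀ v k k', k' ≤ k → (v, k) ∈ D' → (v, k') ∈ D') (u : 𝕍 × ℕ → ℝ) {τ τ' : B}
    (hτ : τ'.1 ≤ τ.1) (htop : ∀ j ∈ D', j ∉ D → IsTop (τ.1 j.1))
    (hbot : ∀ j ∈ D, j ∉ D' → IsBot (τ'.1 j.1)) :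
    ((l.filter (· ∈ D')).foldr (fun j => f j.1 (u j)) τ').1 ≤
      ((l.filter (· ∈ D)).foldr (fun j => f j.1 (u j)) τ).1 := by
  induction l with
  | nil => exact hτ
  | cons j l ih =>
    obtain ⟨hj, hl⟩ := List.pairwise_cons.1 hl
    specialize ih hl
    have hskip : ∀ (E : Finset (𝕍 × ℕ)) (σ : B),
        (∀ v k k', k' ≤ k → (v, k) ∈ E → (v, k') ∈ E) → j ∉ E →
        ((l.filter (· ∈ E)).foldr (fun j => f j.1 (u j)) σ).1 j.1 = σ.1 j.1 := by
      intro E σ hE hjE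
      refine hf.foldr_apply_of_notMem _ u σ j.1 fun i hi hij => hjE ?_
      rw [List.mem_filter, decide_eq_true_iff] at hi
      have := hE i.1 i.2 j.2 (hj i hi.1) hi.2
      rwa [hij] at this
    by_cases h' : j ∈ D' <;> by_cases h : j ∈ D <;>
      simp only [List.filter_cons, h, h', decide_true, decide_false, if_true, if_false,
        List.foldr_cons, Bool.false_eq_true]
    · exact hf.mono _ _ _ _ ih
    · intro w
      rcases eq_or_ne w j.1 with rfl | hw
      · rw [hskip D τ hD h]
        exact htop j h' h _
      · rw [hf.apply_ne _ _ _ _ hw]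
        exact ih w
    · intro w
      rcases eq_or_ne w j.1 with rfl | hw
      · rw [hskip D' τ' hD' h']
        exact hbot j h h' _
      · rw [hf.apply_ne _ _ _ _ hw]
        exact ih w
    · exact ih

/-- The premises in `htop` and `hbot` hold at every site having an update in one box that is absent
from the other. -/
theorem run_le_run {τ τ' : B} (hτ : τ'.1 ≤ τ.1) {V V' : Finset 𝕍} {n n' : ℕ} (t : 𝕍 → ℝ)
    (u : 𝕍 × ℕ → ℝ) (htop : ∀ v ∈ V', (v ∈ V → n < n') → IsTop (τ.1 v))
    (hbot : ∀ v ∈ V, (v ∈ V' → n' < n) → IsBot (τ'.1 v)) :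
    (run f τ' V' n' t u).1 ≤ (run f τ V n t u).1 := by
  classical
  have hdown : ∀ (V : Finset 𝕍) n v k k', k' ≤ k → (v, k) ∈ box V n → (v, k') ∈ box V n := by
    intro V n v k k' hk h
    rw [mem_box] at h ⊢
    exact ⟨h.1, hk.trans_lt h.2⟩
  rw [run, run, ← filter_schedule t (Finset.subset_union_left (s₁ := box V n) (s₂ := box V' n')),
    ← filter_schedule t (Finset.subset_union_right (s₁ := box V n) (s₂ := box V' n'))]
  refine hf.foldr_filter_le ((pairwise_schedule t _).imp fun h => h.time_le) (hdown V n)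
    (hdown V' n') u hτ (fun j hj hj' => ?_) (fun j hj hj' => ?_)
  · rw [mem_box] at hj hj'
    exact htop _ hj.1 fun h => by
      have := not_and.1 hj' h
      omega
  · rw [mem_box] at hj hj'
    exact hbot _ hj.1 fun h => by
      have := not_and.1 hj' h
      omega

/-- From the maximal boundary condition, enlarging the space-time box decreases the state. -/
theorem run_antitone {τ : B} (hτ : ∀ v, IsTop (τ.1 v)) (t : 𝕍 → ℝ) (u : 𝕍 × ℕ → ℝ) :
    Antitone fun i : Finset 𝕍 × ℕ => (run f τ i.1 i.2 t u).1 := fun _ _ hij =>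
  hf.run_le_run le_rfl t u (fun v _ _ => hτ v)
    fun _ hv h => absurd (h (hij.1 hv)) (not_lt.2 hij.2)

theorem run_monotone {τ : B} (hτ : ∀ v, IsBot (τ.1 v)) (t : 𝕍 → ℝ) (u : 𝕍 × ℕ → ℝ) :
    Monotone fun i : Finset 𝕍 × ℕ => (run f τ i.1 i.2 t u).1 := fun _ _ hij =>
  hf.run_le_run le_rfl t u (fun _ hv h => absurd (h (hij.1 hv)) (not_lt.2 hij.2))
    (fun v _ _ => hτ v)

theorem run_bot_le_run_top {τ τ' : B} (hτ : ∀ v, IsTop (τ.1 v)) (hτ' : ∀ v, IsBot (τ'.1 v))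
    (V V' : Finset 𝕍) (n n' : ℕ) (t : 𝕍 → ℝ) (u : 𝕍 × ℕ → ℝ) :
    (run f τ' V' n' t u).1 ≤ (run f τ V n t u).1 :=
  hf.run_le_run (fun v => hτ v _) t u (fun v _ _ => hτ v) (fun v _ _ => hτ' v)

theorem run_smul {t : 𝕍 → ℝ} (ht : Function.Injective t) (u : 𝕍 × ℕ → ℝ) (γ : Γ) {τ : B}
    (hτ : τ.1 = shift γ τ.1) (V : Finset 𝕍) (n : ℕ) (u' : 𝕍 × ℕ → ℝ)
    (hu : ∀ v k, u' (γ • v, k) = u (v, k)) :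
    (run f τ (smulFinset γ V) n (shift γ t) u').1 = shift γ (run f τ V n t u).1 := by
  rw [run, run, schedule_smul ht, List.foldr_map]
  induction schedule t (box V n) with
  | nil => exact hτ
  | cons j l ih =>
    simp only [List.foldr_cons]
    rw [← hf.equivariant γ j.1 (u j) _ _ ih]
    simp [Prod.map, hu]

end IsHeatBath

end Run

/-! ### Convergence of the dynamics in a finite volume -/

section Chain

variable {Γ 𝕍 S : Type*} [Group Γ] [MulAction Γ 𝕍] [Countable 𝕍] [Countable S]
  [MeasurableSpace S] [MeasurableSingletonClass S] {B : Set (𝕍 → S)} [Countable B]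

theorem foldr_bind_eq_bind {C ι : Type*} [MeasurableSpace C] [DiscreteMeasurableSpace C]
    (k : ι → C → Measure C) (l : List ι) (m : Measure C) :
    l.foldr (fun v m => m.bind (k v)) m =
      m.bind fun x => l.foldr (fun v m => m.bind (k v)) (Measure.dirac x) := by
  induction l with
  | nil => exact Measure.bind_dirac.symm
  | cons v l ih =>
    simp only [List.foldr_cons]
    rw [ih, Measure.bind_bind (Measurable.of_discrete).aemeasurable
      (Measurable.of_discrete).aemeasurable]

theorem isProbabilityMeasure_foldr_bind {C ι : Type*} [MeasurableSpace C]
    [DiscreteMeasurableSpace C] {k : ι → C → Measure C} (hk : ∀ v x, IsProbabilityMeasure (k v x))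
    (l : List ι) (m : Measure C) [IsProbabilityMeasure m] :
    IsProbabilityMeasure (l.foldr (fun v m => m.bind (k v)) m) := by
  induction l with
  | nil => assumption
  | cons v l ih =>
    refine ⟨?_⟩
    simp only [List.foldr_cons]
    rw [Measure.bind_apply .univ (Measurable.of_discrete).aemeasurable]
    simp

theorem bind_ne_zero {C : Type*} [MeasurableSpace C] [DiscreteMeasurableSpace C] {m : Measure C}
    {k : C → Measure C} {x y : C} (hx : m {x} ≠ 0) (hxy : k x {y} ≠ 0) : m.bind k {y} ≠ 0 := by
  rw [Measure.bind_apply .of_discrete (Measurable.of_discrete).aemeasurable]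
  refine ne_of_gt (lt_of_lt_of_le ?_ (setLIntegral_le_lintegral {x} _))
  rw [lintegral_singleton]
  exact pos_iff_ne_zero.2 (mul_ne_zero hxy hx)

namespace Specification

/-- The transition kernel of successive single-site resamplings along a list (last site first). -/
noncomputable def sweepKernel (ρ : Specification B) (l : List 𝕍) (x : B) : Measure B :=
  l.foldr (fun v m => m.bind (ρ.stateLaw {v})) (Measure.dirac x)

variable {ρ : Specification B} {V : Finset 𝕍} {τ : B}

theorem foldr_bind_stateLaw_le (hB : ∀ τ ∈ B, ∀ V, agreeOff V τ ⊆ B) {l : List 𝕍}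
    (hl : ∀ v ∈ l, v ∈ V) {m : Measure B} {c : ENNReal} (hm : m ≤ c • ρ.stateLaw V τ) :
    l.foldr (fun v m => m.bind (ρ.stateLaw {v})) m ≤ c • ρ.stateLaw V τ := by
  induction l with
  | nil => exact hm
  | cons v l ih =>
    specialize ih fun w hw => hl w (List.mem_cons_of_mem _ hw)
    refine Measure.le_iff.2 fun A hA => ?_
    simp only [List.foldr_cons]
    rw [Measure.bind_apply hA (Measurable.of_discrete).aemeasurable]
    refine (lintegral_mono' ih le_rfl).trans ?_
    rw [lintegral_smul_measure, ← Measure.bind_apply hA (Measurable.of_discrete).aemeasurable,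
      bind_stateLaw hB (hl v List.mem_cons_self)]
    rfl

theorem bind_sweepKernel (hB : ∀ τ ∈ B, ∀ V, agreeOff V τ ⊆ B) {l : List 𝕍}
    (hl : ∀ v ∈ l, v ∈ V) : (ρ.stateLaw V τ).bind (ρ.sweepKernel l) = ρ.stateLaw V τ := by
  unfold sweepKernel
  rw [← foldr_bind_eq_bind]
  induction l with
  | nil => rfl
  | cons v l ih =>
    rw [List.foldr_cons, ih fun w hw => hl w (List.mem_cons_of_mem _ hw),
      bind_stateLaw hB (hl v List.mem_cons_self)]

theorem sweepKernel_self_ne_zero {l : List 𝕍} (hl : ∀ v ∈ l, v ∈ V) {x : B}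
    (hx : ρ.stateLaw V τ {x} ≠ 0) : ρ.sweepKernel l x {x} ≠ 0 := by
  induction l with
  | nil => simp [sweepKernel]
  | cons v l ih =>
    exact bind_ne_zero (ih fun w hw => hl w (List.mem_cons_of_mem _ hw))
      (stateLaw_self_ne_zero (hl v List.mem_cons_self) (fun _ _ => rfl) hx)

/-- An update keeps a state of positive probability with positive probability. The sweep therefore
may hold `x`, move to `y` at the first update of `v`, and hold `y` afterwards. -/
theorem sweepKernel_ne_zero {l : List 𝕍} (hl : ∀ v ∈ l, v ∈ V) {v : 𝕍} (hv : v ∈ l) {x y : B}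
    (hx : ρ.stateLaw V τ {x} ≠ 0) (hy : ρ.stateLaw V τ {y} ≠ 0) (hxy : y.1 ∈ agreeOff {v} x.1) :
    ρ.sweepKernel l x {y} ≠ 0 := by
  induction l with
  | nil => simp at hv
  | cons w l ih =>
    have hl' : ∀ v ∈ l, v ∈ V := fun v hv => hl v (List.mem_cons_of_mem _ hv)
    by_cases hvl : v ∈ l
    · exact bind_ne_zero (ih hl' hvl)
        (stateLaw_self_ne_zero (hl w List.mem_cons_self) (fun _ _ => rfl) hy)
    · obtain rfl : v = w := (List.mem_cons.1 hv).resolve_right hvl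
      exact bind_ne_zero (sweepKernel_self_ne_zero hl' hx)
        (stateLaw_self_ne_zero (hl v List.mem_cons_self) hxy hy)

theorem IrreducibleAt.reflTransGen (hB : ∀ τ ∈ B, ∀ V, agreeOff V τ ⊆ B)
    (h : ρ.IrreducibleAt τ) {l : List 𝕍}
    (hl : ∀ v, v ∈ l ↔ v ∈ V) {x y : B} (hx : ρ.stateLaw V τ {x} ≠ 0)
    (hy : ρ.stateLaw V τ {y} ≠ 0) :
    Relation.ReflTransGen (fun a b => ρ.sweepKernel l a {b} ≠ 0) x y := by
  have hsupp : ∀ z : B, z.1 ∈ ρ.support V τ ↔ ρ.stateLaw V τ {z} ≠ 0 := fun z => by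
    rw [stateLaw_singleton]; rfl
  have hmemB : ∀ z ∈ ρ.support V τ, z ∈ B := fun z hz => hB τ.1 τ.2 V <| by
    by_contra h
    exact hz (measure_mono_null (Set.singleton_subset_iff.2 h) (ρ.supported V τ))
  have hreach := (h V).2.preconnected ⟨x.1, (hsupp x).2 hx⟩ ⟨y.1, (hsupp y).2 hy⟩
  rw [SimpleGraph.reachable_iff_reflTransGen] at hreach
  refine Relation.ReflTransGen.lift (r := ((hammingGraph 𝕍 S).induce (ρ.support V τ)).Adj)
    (p := fun a b : B => ρ.sweepKernel l a {b} ≠ 0)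
    (f := fun z => (⟨z.1, hmemB z.1 z.2⟩ : B)) (fun a b hab => ?_) _ _ hreach
  obtain ⟨v, hv, huniq⟩ : ∃! v, a.1 v ≠ b.1 v := hab
  have ha : ρ.stateLaw V τ {⟨a.1, hmemB a.1 a.2⟩} ≠ 0 := (hsupp _).1 a.2
  have hb : ρ.stateLaw V τ {⟨b.1, hmemB b.1 b.2⟩} ≠ 0 := (hsupp _).1 b.2
  have hvV : v ∈ V := by
    by_contra hvV
    exact hv ((mem_agreeOff_of_stateLaw_ne_zero ha v hvV).trans
      (mem_agreeOff_of_stateLaw_ne_zero hb v hvV).symm)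
  refine sweepKernel_ne_zero (fun w => (hl w).1) ((hl v).2 hvV) ha hb fun w hw => ?_
  by_contra hne
  exact hw (Finset.mem_singleton.2 (huniq w (Ne.symm hne)))

end Specification

/-- The law of the update variables. -/
noncomputable abbrev noiseLaw (𝕍 : Type*) : Measure (𝕍 × ℕ → ℝ) :=
  Measure.infinitePi fun _ : 𝕍 × ℕ => unitLaw

namespace IsHeatBath

variable [LinearOrder S] {ρ : Specification B} {f : 𝕍 → ℝ → B → B} (hf : IsHeatBath Γ ρ f)
  (hB : ∀ τ ∈ B, ∀ V, agreeOff V τ ⊆ B)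

include hf

theorem measurable_run (τ : B) (V : Finset 𝕍) (n : ℕ) (t : 𝕍 → ℝ) :
    Measurable (run f τ V n t) :=
  measurable_foldr (f := fun (j : 𝕍 × ℕ) (u : 𝕍 × ℕ → ℝ) => f j.1 (u j))
    (fun j c => (hf.measurable j.1 c).comp (measurable_pi_apply j)) _ τ

theorem map_run (τ : B) (V : Finset 𝕍) (n : ℕ) (t : 𝕍 → ℝ) :
    (noiseLaw 𝕍).map (run f τ V n t) =
      ρ.sweepKernel ((schedule t (box V n)).map Prod.fst) τ := by
  have h := map_foldr_infinitePi (p := unitLaw) (f := fun j : 𝕍 × ℕ => f j.1)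
    (fun j c => hf.measurable j.1 c) (nodup_schedule t (box V n)) τ
  simp_rw [hf.law] at h
  rw [Specification.sweepKernel, List.foldr_map]
  exact h

theorem map_run_succ (τ : B) (V : Finset 𝕍) (n : ℕ) (t : 𝕍 → ℝ) :
    (noiseLaw 𝕍).map (run f τ V (n + 1) t) = ((noiseLaw 𝕍).map (run f τ V n t)).bind
      (ρ.sweepKernel ((schedule t (box V 1)).map Prod.fst)) := by
  rw [hf.map_run, hf.map_run, map_fst_schedule_box_succ]
  unfold Specification.sweepKernel
  rw [List.foldr_append, foldr_bind_eq_bind]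

include hB

/-- The constant is what the point mass at `τ` needs; each resampling preserves `ρ_V^τ` and hence
the bound. Its uniformity in `n` yields both tightness and absolute continuity of the limit. -/
theorem map_run_le {τ : B} {V : Finset 𝕍} (hτ : ρ.stateLaw V τ {τ} ≠ 0) (n : ℕ) (t : 𝕍 → ℝ) :
    (noiseLaw 𝕍).map (run f τ V n t) ≤ (ρ.stateLaw V τ {τ})⁻¹ • ρ.stateLaw V τ := by
  have := ρ.isProbabilityMeasure_stateLaw V τ hB
  rw [hf.map_run]
  refine Specification.foldr_bind_stateLaw_le hB (fun v hv => ?_) ?_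
  · obtain ⟨j, hj, rfl⟩ := List.mem_map.1 hv
    exact (mem_box.1 (mem_schedule.1 hj)).1
  · refine Measure.le_iff.2 fun A hA => ?_
    rw [Measure.dirac_apply' _ hA]
    by_cases h : τ ∈ A
    · rw [Set.indicator_of_mem h, Pi.one_apply, Measure.smul_apply, smul_eq_mul,
        ← ENNReal.inv_mul_cancel hτ (measure_ne_top _ _)]
      gcongr
      exact Set.singleton_subset_iff.2 h
    · simp [Set.indicator_of_notMem h]

/-- If the dynamics in `V` started from `τ` stabilises, then its limit has law `ρ_V^τ`. -/
theorem tendsto_integral_run {τ : B} (hirr : ρ.IrreducibleAt τ) (V : Finset 𝕍) (t : 𝕍 → ℝ)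
    (hconv : ∀ᵐ u ∂noiseLaw 𝕍, ∀ v ∈ V, ∃ s, ∀ᶠ n in atTop, (run f τ V n t u).1 v = s)
    (g : B → ℝ) {c : ℝ} (hg : ∀ x, |g x| ≤ c) :
    Tendsto (fun n => ∫ u, g (run f τ V n t u) ∂noiseLaw 𝕍) atTop
      (𝓝 (∫ x, g x ∂ρ.stateLaw V τ)) := by
  have := ρ.isProbabilityMeasure_stateLaw V τ hB
  have hτ : ρ.stateLaw V τ {τ} ≠ 0 := by
    rw [ρ.stateLaw_singleton]; exact (hirr V).1
  set l := (schedule t (box V 1)).map Prod.fst with hldef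
  have hl : ∀ v, v ∈ l ↔ v ∈ V := by
    intro v
    simp [hldef, mem_schedule, mem_box]
  have hX : ∀ᵐ u ∂noiseLaw 𝕍, ∃ x : B, ∀ᶠ n in atTop, run f τ V n t u = x := by
    filter_upwards [hconv] with u hu
    rcases V.eq_empty_or_nonempty with rfl | ⟨v₀, _⟩
    · exact ⟨τ, .of_forall fun n => Subtype.ext (funext fun v =>
        hf.run_mem_agreeOff τ ∅ n t u v (by simp))⟩
    have : Nonempty S := ⟨τ.1 v₀⟩
    choose! s hs using hu
    have hall : ∀ᶠ n in atTop, ∀ v ∈ V, (run f τ V n t u).1 v = s v :=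
      (Filter.eventually_all_finset V).2 hs
    obtain ⟨N, hN⟩ := eventually_atTop.1 hall
    refine ⟨run f τ V N t u, eventually_atTop.2 ⟨N, fun n hn => Subtype.ext (funext fun v => ?_)⟩⟩
    by_cases hv : v ∈ V
    · rw [hN n hn v hv, hN N le_rfl v hv]
    · rw [hf.run_mem_agreeOff τ V n t u v hv, hf.run_mem_agreeOff τ V N t u v hv]
  set X : (𝕍 × ℕ → ℝ) → B := fun u => eventualValue τ fun n => run f τ V n t u
  have hXm : Measurable X := measurable_eventualValue τ fun n => hf.measurable_run τ V n t
  have hXev : ∀ᵐ u ∂noiseLaw 𝕍, ∀ᶠ n in atTop, run f τ V n t u = X u :=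
    hX.mono fun u hu => eventually_eq_eventualValue τ hu
  set m := (noiseLaw 𝕍).map X with hmdef
  have hmp : IsProbabilityMeasure m := Measure.isProbabilityMeasure_map hXm.aemeasurable
  have hlim : ∀ h : B → ENNReal, (∀ x, h x ≤ 1) →
      Tendsto (fun n => ∫⁻ x, h x ∂(noiseLaw 𝕍).map (run f τ V n t)) atTop
        (𝓝 (∫⁻ x, h x ∂m)) := by
    intro h hh
    have hhm : Measurable h := .of_discrete
    rw [hmdef, lintegral_map hhm hXm]
    refine Tendsto.congr (fun n => (lintegral_map hhm (hf.measurable_run τ V n t)).symm) ?_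
    refine tendsto_lintegral_of_dominated_convergence (fun _ => 1)
      (fun n => hhm.comp (hf.measurable_run τ V n t)) (fun n => .of_forall fun u => hh _)
      (by simp) ?_
    filter_upwards [hXev] with u hu
    exact tendsto_const_nhds.congr' (hu.mono fun n hn => congrArg h hn.symm)
  have hKp : ∀ x, IsProbabilityMeasure (ρ.sweepKernel l x) := fun x =>
    isProbabilityMeasure_foldr_bind (fun v x => ρ.isProbabilityMeasure_stateLaw {v} x hB) _ _
  have hmeasure : ∀ (A : Set B), Tendsto (fun n => (noiseLaw 𝕍).map (run f τ V n t) A) atTop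
      (𝓝 (m A)) := by
    intro A
    have hA : MeasurableSet A := .of_discrete
    simpa [lintegral_indicator_one hA] using hlim (A.indicator 1)
      (Set.indicator_le_self' (by simp))
  -- One more sweep multiplies the law by the kernel; both sides of this recursion converge.
  have hstat : m.bind (ρ.sweepKernel l) = m := by
    refine Measure.ext_of_singleton fun y => ?_
    refine tendsto_nhds_unique ?_ ((tendsto_add_atTop_iff_nat 1).2 (hmeasure {y}))
    have hKm : Measurable (ρ.sweepKernel l) := .of_discrete
    rw [Measure.bind_apply (measurableSet_singleton y) hKm.aemeasurable]
    refine (hlim (fun x => ρ.sweepKernel l x {y}) fun x => prob_le_one).congr fun n => ?_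
    rw [hf.map_run_succ, Measure.bind_apply (measurableSet_singleton y) hKm.aemeasurable]
  have hac : m ≪ ρ.stateLaw V τ := by
    intro A hA
    refine tendsto_nhds_unique (hmeasure A) (tendsto_const_nhds.congr fun n => ?_)
    refine (le_antisymm ((hf.map_run_le hB hτ n t) A |>.trans ?_) zero_le).symm
    simp [hA]
  have := eq_of_stationary hstat
    (Specification.bind_sweepKernel hB fun v hv => (hl v).1 hv) hac
    fun x y hx hy => hirr.reflTransGen hB hl hx hy
  rw [← this, hmdef, integral_map hXm.aemeasurable (Measurable.of_discrete).aestronglyMeasurable]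
  refine tendsto_integral_of_dominated_convergence (fun _ => c) (fun n => ?_)
    (integrable_const c) (fun n => .of_forall fun u => hg _) ?_
  · exact (Measurable.of_discrete.comp (hf.measurable_run τ V n t)).aestronglyMeasurable
  · filter_upwards [hXev] with u hu
    exact tendsto_const_nhds.congr' (hu.mono fun n hn => congrArg g hn.symm)

end IsHeatBath

end Chain

/-! ### The i.i.d. source -/

section Source

variable {Γ 𝕍 : Type*} [Group Γ] [MulAction Γ 𝕍] [Countable 𝕍]

/-- The variables attached to a site: a label and a sequence of update variables. -/
abbrev Source : Type := Option ℕ → ℝ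

/-- The common law of the variables attached to a site. -/
noncomputable def sourceLaw : Measure Source := Measure.infinitePi fun _ => unitLaw

instance : IsProbabilityMeasure sourceLaw := by unfold sourceLaw; infer_instance

instance : IsProbabilityMeasure (iidLaw 𝕍 sourceLaw) := by unfold iidLaw; infer_instance

/-- The labels of the sites. -/
def labels (y : 𝕍 → Source) : 𝕍 → ℝ := fun v => y v none

/-- The update variables of the sites. -/
def noise (y : 𝕍 → Source) : 𝕍 × ℕ → ℝ := fun j => y j.1 (some j.2)

/-- The law of the labels. -/
noncomputable abbrev labelLaw (𝕍 : Type*) : Measure (𝕍 → ℝ) :=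
  Measure.infinitePi fun _ : 𝕍 => unitLaw

theorem measurable_labels : Measurable (labels : (𝕍 → Source) → 𝕍 → ℝ) := by
  unfold labels; fun_prop

theorem measurable_noise : Measurable (noise : (𝕍 → Source) → 𝕍 × ℕ → ℝ) := by
  unfold noise; fun_prop

/-- Labels and update variables are disjoint blocks of one i.i.d. family; splicing two independent
copies along the label block exhibits the product law. -/
theorem map_labels_noise : (iidLaw 𝕍 sourceLaw).map (fun y => (labels y, noise y)) =
    (labelLaw 𝕍).prod (noiseLaw 𝕍) := by
  classical
  set Z := Measure.infinitePi fun _ : 𝕍 × Option ℕ => unitLaw with hZ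
  set a : (𝕍 × Option ℕ → ℝ) → 𝕍 → ℝ := fun z v => z (v, none) with ha
  set b : (𝕍 × Option ℕ → ℝ) → 𝕍 × ℕ → ℝ := fun z j => z (j.1, some j.2) with hb
  have ham : Measurable a := by fun_prop
  have hbm : Measurable b := by fun_prop
  have hia : Function.Injective fun v : 𝕍 => (v, (none : Option ℕ)) :=
    fun v w h => (Prod.ext_iff.1 h).1
  have hib : Function.Injective fun j : 𝕍 × ℕ => (j.1, some j.2) := fun i j h =>
    Prod.ext (Prod.ext_iff.1 h).1 (Option.some_injective _ (Prod.ext_iff.1 h).2)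
  have hZa : Z.map a = labelLaw 𝕍 := Measure.map_infinitePi_infinitePi_of_inj hia
  have hZb : Z.map b = noiseLaw 𝕍 := Measure.map_infinitePi_infinitePi_of_inj hib
  have hcurry : iidLaw 𝕍 sourceLaw = Z.map (MeasurableEquiv.curry 𝕍 (Option ℕ) ℝ) :=
    (Measure.infinitePi_map_curry fun (_ : 𝕍) (_ : Option ℕ) => unitLaw).symm
  have hs := infinitePi_prod_map_splice (p := unitLaw)
    (Set.range fun v : 𝕍 => (v, (none : Option ℕ)))
  rw [hcurry, Measure.map_map (measurable_labels.prodMk measurable_noise)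
    (MeasurableEquiv.measurable _), ← hZa, ← hZb, Measure.map_prod_map _ _ ham hbm, hZ]
  conv_lhs => rw [← hs]
  rw [Measure.map_map ((measurable_labels.prodMk measurable_noise).comp
    (MeasurableEquiv.measurable _)) (measurable_splice _)]
  congr 1
  funext q
  refine Prod.ext (funext fun v => ?_) (funext fun j => ?_)
  · simp [labels, ha, MeasurableEquiv.curry, Function.curry]
  · simp [noise, hb, MeasurableEquiv.curry, Function.curry]

theorem ae_injective_labels :
    ∀ᵐ y ∂iidLaw 𝕍 sourceLaw, Function.Injective (labels y) := by
  have h1 : ∀ᵐ t ∂labelLaw 𝕍, Function.Injective t := by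
    have : ∀ᵐ t ∂labelLaw 𝕍, ∀ v w : 𝕍, v ≠ w → t v ≠ t w := by
      refine ae_all_iff.2 fun v => ae_all_iff.2 fun w => ?_
      by_cases hvw : v = w
      · simp [hvw]
      have hm : Measurable fun t : 𝕍 → ℝ => (t v, t w) := by fun_prop
      have h2 : ∀ᵐ q ∂(unitLaw.prod unitLaw), q.1 ≠ q.2 := by
        rw [Measure.ae_prod_iff_ae_ae (p := fun q : ℝ × ℝ => q.1 ≠ q.2)
          (measurableSet_eq_fun measurable_fst measurable_snd).compl]
        refine .of_forall fun x => ?_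
        have : unitLaw {x} = 0 := measure_singleton x
        rw [ae_iff]
        refine measure_mono_null (fun z hz => ?_) this
        simpa [eq_comm] using hz
      rw [← Measure.infinitePi_map_eval_prod (P := fun _ : 𝕍 => unitLaw) hvw] at h2
      filter_upwards [ae_of_ae_map hm.aemeasurable h2] with t ht _ using ht
    filter_upwards [this] with t ht v w hvw
    by_contra h
    exact ht v w h hvw
  have h2 : (iidLaw 𝕍 sourceLaw).map labels = labelLaw 𝕍 := by
    have := congrArg (Measure.map Prod.fst) (map_labels_noise (𝕍 := 𝕍))
    rwa [Measure.map_map measurable_fst (measurable_labels.prodMk measurable_noise),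
      Measure.map_fst_prod, measure_univ, one_smul] at this
  rw [← h2] at h1
  exact ae_of_ae_map measurable_labels.aemeasurable h1

theorem measurableSet_updateLE (i j : 𝕍 × ℕ) : MeasurableSet {t : 𝕍 → ℝ | UpdateLE t i j} := by
  have h : {t : 𝕍 → ℝ | UpdateLE t i j} = {_t | i.2 < j.2} ∪ {_t | i.2 = j.2} ∩
      ({t | t i.1 < t j.1} ∪ {t | t i.1 = t j.1} ∩
        {_t | siteIndex 𝕍 i.1 ≤ siteIndex 𝕍 j.1}) := by
    ext t
    exact updateLE_iff
  rw [h]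
  exact (MeasurableSet.const _).union ((MeasurableSet.const _).inter
    ((measurableSet_lt (measurable_pi_apply i.1) (measurable_pi_apply j.1)).union
      ((measurableSet_eq_fun (measurable_pi_apply i.1) (measurable_pi_apply j.1)).inter
        (MeasurableSet.const _))))

theorem measurableSet_schedule_eq (D : Finset (𝕍 × ℕ)) (l : List (𝕍 × ℕ)) :
    MeasurableSet {t : 𝕍 → ℝ | schedule t D = l} := by
  have hp : MeasurableSet {t : 𝕍 → ℝ | l.Pairwise (UpdateLE t)} := by
    induction l with
    | nil => simp
    | cons i l ih =>
      have : {t : 𝕍 → ℝ | (i :: l).Pairwise (UpdateLE t)} =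
          (⋂ j, ⋂ (_ : j ∈ l), {t | UpdateLE t i j}) ∩ {t | l.Pairwise (UpdateLE t)} := by
        ext t
        simp [List.pairwise_cons]
      rw [this]
      exact (MeasurableSet.iInter fun j => MeasurableSet.iInter fun _ =>
        measurableSet_updateLE i j).inter ih
  by_cases h : l.Nodup ∧ ∀ j, j ∈ l ↔ j ∈ D
  · convert! hp using 1
    ext t
    exact ⟨fun (h' : schedule t D = l) => h' ▸ pairwise_schedule t D,
      fun h' => (eq_schedule h.1 h.2 h').symm⟩
  · convert! MeasurableSet.empty using 1
    refine Set.eq_empty_of_forall_notMem fun t (ht : schedule t D = l) => h ?_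
    exact ht ▸ ⟨nodup_schedule t D, fun _ => mem_schedule⟩

end Source

/-! ### The infinite-volume limit and its equivariance -/

section Limit

variable {Γ 𝕍 S : Type*} [Group Γ] [MulAction Γ 𝕍] [Countable 𝕍] [Countable S]
  [MeasurableSpace S] [MeasurableSingletonClass S] {B : Set (𝕍 → S)} [Countable B]
  [LinearOrder S] {ρ : Specification B} {f : 𝕍 → ℝ → B → B}

/-- The state at time zero of the dynamics in a space-time box. -/
noncomputable def boxState (f : 𝕍 → ℝ → B → B) (τ : B) (i : Finset 𝕍 × ℕ) (y : 𝕍 → Source) : B :=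
  run f τ i.1 i.2 (labels y) (noise y)

/-- The limit of the states at time zero of the dynamics in large space-time boxes. -/
noncomputable def limitState (f : 𝕍 → ℝ → B → B) (τ : B) (y : 𝕍 → Source) : 𝕍 → S :=
  fun v => eventualValue (τ.1 v) fun i : Finset 𝕍 × ℕ => (boxState f τ i y).1 v

namespace IsHeatBath

variable (hf : IsHeatBath Γ ρ f)
include hf

/-- The schedule takes countably many values, each on a measurable set of labels, and for a fixed
list the state is measurable in the update variables. -/
theorem measurable_run_prod (τ : B) (V : Finset 𝕍) (n : ℕ) :
    Measurable fun q : (𝕍 → ℝ) × (𝕍 × ℕ → ℝ) => run f τ V n q.1 q.2 := by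
  refine measurable_to_countable' fun x => ?_
  have : (fun q : (𝕍 → ℝ) × (𝕍 × ℕ → ℝ) => run f τ V n q.1 q.2) ⁻¹' {x} =
      ⋃ l : List (𝕍 × ℕ), {t | schedule t (box V n) = l} ×ˢ
        ((fun u : 𝕍 × ℕ → ℝ => l.foldr (fun j => f j.1 (u j)) τ) ⁻¹' {x}) := by
    ext q
    simp [run]
  rw [this]
  refine .iUnion fun l => (measurableSet_schedule_eq _ l).prod ?_
  exact measurable_foldr (f := fun (j : 𝕍 × ℕ) (u : 𝕍 × ℕ → ℝ) => f j.1 (u j))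
    (fun j c => (hf.measurable j.1 c).comp (measurable_pi_apply j)) l τ (measurableSet_singleton x)

theorem measurable_boxState (τ : B) (i : Finset 𝕍 × ℕ) : Measurable (boxState f τ i) :=
  (hf.measurable_run_prod τ i.1 i.2).comp (measurable_labels.prodMk measurable_noise)

theorem measurable_limitState (τ : B) : Measurable (limitState f τ) := by
  classical
  exact measurable_pi_lambda _ fun v => measurable_eventualValue _ fun i =>
    (measurable_pi_apply v).comp (measurable_subtype_coe.comp (hf.measurable_boxState τ i))

/-- The dynamics in a fixed volume converges to the finite-volume law. -/
theorem tendsto_integral_boxState (hB : ∀ τ ∈ B, ∀ V, agreeOff V τ ⊆ B) {τ : B}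
    (hirr : ρ.IrreducibleAt τ) (V : Finset 𝕍)
    (hconv : ∀ t, ∀ᵐ u ∂noiseLaw 𝕍, ∀ v ∈ V, ∃ s, ∀ᶠ n in atTop, (run f τ V n t u).1 v = s)
    (g : B → ℝ) {c : ℝ} (hg : ∀ x, |g x| ≤ c) :
    Tendsto (fun n => ∫ y, g (boxState f τ (V, n) y) ∂iidLaw 𝕍 sourceLaw) atTop
      (𝓝 (∫ x, g x ∂ρ.stateLaw V τ)) := by
  have hgm : ∀ n, Measurable fun q : (𝕍 → ℝ) × (𝕍 × ℕ → ℝ) => g (run f τ V n q.1 q.2) := fun n =>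
    (Measurable.of_discrete (f := g)).comp (hf.measurable_run_prod τ V n)
  -- Given the labels, the order of a sweep is fixed and the Markov chain argument applies; the
  -- limit does not depend on them.
  have hint : ∀ n, ∫ y, g (boxState f τ (V, n) y) ∂iidLaw 𝕍 sourceLaw =
      ∫ t, ∫ u, g (run f τ V n t u) ∂noiseLaw 𝕍 ∂labelLaw 𝕍 := by
    intro n
    rw [← integral_prod (fun q : (𝕍 → ℝ) × (𝕍 × ℕ → ℝ) => g (run f τ V n q.1 q.2)),
      ← map_labels_noise, integral_map (measurable_labels.prodMk measurable_noise).aemeasurable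
      (hgm n).aestronglyMeasurable]
    · rfl
    · exact Integrable.of_bound (hgm n).aestronglyMeasurable c (.of_forall fun q => hg _)
  simp_rw [hint]
  have hconst : ∫ x, g x ∂ρ.stateLaw V τ = ∫ _t, ∫ x, g x ∂ρ.stateLaw V τ ∂labelLaw 𝕍 := by simp
  rw [hconst]
  refine tendsto_integral_of_dominated_convergence (fun _ => c) (fun n => ?_)
    (integrable_const c) (fun n => .of_forall fun t => ?_) (.of_forall fun t => ?_)
  · exact (hgm n).stronglyMeasurable.integral_prod_right'.aestronglyMeasurable
  · have := norm_integral_le_of_norm_le_const (μ := noiseLaw 𝕍) (f := fun u => g (run f τ V n t u))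
      (.of_forall fun u => hg _)
    simpa using this
  · exact hf.tendsto_integral_run hB hirr V t (hconv t) g hg

variable [TopologicalSpace S] [DiscreteTopology S] [BorelSpace S]

/-- If the dynamics stabilises, then the law of its limit is the infinite-volume limit. -/
theorem isLimit_map_limitState (hB : ∀ τ ∈ B, ∀ V, agreeOff V τ ⊆ B) {τ : B}
    (hirr : ρ.IrreducibleAt τ)
    (hconv : ∀ V t, ∀ᵐ u ∂noiseLaw 𝕍, ∀ v ∈ V, ∃ s, ∀ᶠ n in atTop, (run f τ V n t u).1 v = s)
    (hlim : ∀ v, ∀ᵐ y ∂iidLaw 𝕍 sourceLaw, ∃ s, ∀ᶠ i in atTop, (boxState f τ i y).1 v = s) :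
    ρ.IsLimit τ ⟨(iidLaw 𝕍 sourceLaw).map (limitState f τ),
      Measure.isProbabilityMeasure_map (hf.measurable_limitState τ).aemeasurable⟩ := by
  classical
  refine ProbabilityMeasure.tendsto_iff_forall_integral_tendsto.2 fun g => ?_
  have hgb : ∀ ω, |g ω| ≤ ‖g‖ := fun ω => g.norm_coe_le_norm ω
  have hgm : Measurable g := g.continuous.measurable
  have hjoint : Tendsto (fun i => ∫ y, g (boxState f τ i y).1 ∂iidLaw 𝕍 sourceLaw) atTop
      (𝓝 (∫ ω, g ω ∂(iidLaw 𝕍 sourceLaw).map (limitState f τ))) := by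
    rw [integral_map (hf.measurable_limitState τ).aemeasurable hgm.aestronglyMeasurable]
    refine tendsto_integral_filter_of_dominated_convergence (fun _ => ‖g‖) (.of_forall fun i => ?_)
      (.of_forall fun i => .of_forall fun y => hgb _) (integrable_const _) ?_
    · exact (hgm.comp (measurable_subtype_coe.comp
        (hf.measurable_boxState τ i))).aestronglyMeasurable
    · filter_upwards [ae_all_iff.2 hlim] with y hy
      refine (g.continuous.tendsto _).comp (tendsto_pi_nhds.2 fun v => ?_)
      exact tendsto_const_nhds.congr' ((eventually_eq_eventualValue (τ.1 v) (hy v)).mono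
        fun i hi => hi.symm)
  -- The joint limit controls all boxes beyond `(V₀, n₀)`. For fixed `V ⊇ V₀`, letting `n → ∞`
  -- transfers the bound to `ρ_V^τ`.
  refine Metric.tendsto_atTop.2 fun ε hε => ?_
  obtain ⟨⟨V₀, n₀⟩, h₀⟩ := Metric.tendsto_atTop.1 hjoint (ε / 2) (half_pos hε)
  refine ⟨V₀, fun V hV => ?_⟩
  have h1 := hf.tendsto_integral_boxState hB hirr V (hconv V) (fun x => g x.1) fun x => hgb _
  have h2 : ∫ x, g x.1 ∂ρ.stateLaw V τ = ∫ ω, g ω ∂(ρ.law V τ : Measure (𝕍 → S)) := by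
    rw [← ρ.map_val_stateLaw V τ hB, integral_map measurable_subtype_coe.aemeasurable
      hgm.aestronglyMeasurable]
  rw [h2] at h1
  refine lt_of_le_of_lt (le_of_tendsto (h1.dist tendsto_const_nhds)
    (eventually_atTop.2 ⟨n₀, fun n hn => ?_⟩)) (half_lt_self hε)
  exact (h₀ (V, n) ⟨hV, hn⟩).le

end IsHeatBath

theorem tendsto_smulFinset (γ : Γ) :
    Tendsto (fun i : Finset 𝕍 × ℕ => (smulFinset γ i.1, i.2)) atTop atTop := by
  classical
  refine tendsto_atTop.2 fun ⟨V, n⟩ => eventually_atTop.2 ⟨(smulFinset γ⁻¹ V, n), ?_⟩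
  rintro ⟨W, m⟩ ⟨hW, hm⟩
  refine ⟨fun v hv => ?_, hm⟩
  obtain ⟨v, rfl⟩ := MulAction.surjective γ v
  refine mem_smulFinset.2 (hW ?_)
  have := (mem_smulFinset (γ := γ⁻¹)).2 hv
  rwa [inv_smul_smul] at this

theorem smulFinset_inv_smulFinset (γ : Γ) (V : Finset 𝕍) :
    smulFinset γ (smulFinset γ⁻¹ V) = V := by
  ext v
  obtain ⟨v, rfl⟩ := MulAction.surjective γ v
  rw [mem_smulFinset]
  have := mem_smulFinset (γ := γ⁻¹) (V := V) (v := γ • v)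
  rwa [inv_smul_smul] at this

namespace IsHeatBath

variable (hf : IsHeatBath Γ ρ f)
include hf

theorem limitState_shift {τ : B} (hτ : ∀ γ : Γ, τ.1 = shift γ τ.1) (γ : Γ) {y : 𝕍 → Source}
    (hy : Function.Injective (labels y)) :
    limitState f τ (shift γ y) = shift γ (limitState f τ y) := by
  classical
  have hbox : ∀ (i : Finset 𝕍 × ℕ) v,
      (boxState f τ (smulFinset γ i.1, i.2) (shift γ y)).1 (γ • v) = (boxState f τ i y).1 v := by
    intro i v
    have h := hf.run_smul hy (noise y) γ (hτ γ) i.1 i.2 (noise (shift γ y))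
      (fun v k => by simp [noise])
    exact (congrFun h (γ • v)).trans (shift_smul γ _ v)
  funext v
  obtain ⟨v, rfl⟩ := MulAction.surjective γ v
  rw [shift_smul]
  -- Equivariance is also needed at points where the net does not stabilise, so the default value
  -- has to be invariant.
  have hd : τ.1 (γ • v) = τ.1 v := by
    conv_lhs => rw [hτ γ]
    exact shift_smul γ _ v
  have hiff : ∀ s, (∀ᶠ i in atTop, (boxState f τ i (shift γ y)).1 (γ • v) = s) ↔
      ∀ᶠ i in atTop, (boxState f τ i y).1 v = s := by
    intro s
    constructor
    · intro h
      filter_upwards [(tendsto_smulFinset γ).eventually h] with i hi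
      rw [← hi, hbox]
    · intro h
      filter_upwards [(tendsto_smulFinset γ⁻¹).eventually h] with i hi
      rw [← hi, ← hbox]
      simp only [smulFinset_inv_smulFinset]
  by_cases h : ∃ s, ∀ᶠ i in atTop, (boxState f τ i y).1 v = s
  · obtain ⟨s, hs⟩ := h
    exact (eventualValue_eq ((hiff s).2 hs)).trans (eventualValue_eq hs).symm
  · have h' : ¬ ∃ s, ∀ᶠ i in atTop, (boxState f τ i (shift γ y)).1 (γ • v) = s := by
      simpa only [hiff] using h
    rw [limitState, limitState, eventualValue, eventualValue, dif_neg h, dif_neg h', hd]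

theorem isCoding {τ : B} (hτ : ∀ γ : Γ, τ.1 = shift γ τ.1) :
    IsCoding Γ sourceLaw (limitState f τ) ((iidLaw 𝕍 sourceLaw).map (limitState f τ)) where
  measurable := hf.measurable_limitState τ
  law := rfl
  equivariant := by
    refine ⟨{y | Function.Injective (labels y)}, ?_, ae_injective_labels, fun γ y hy => ?_,
      fun γ y hy => hf.limitState_shift hτ γ hy⟩
    · have : {y : 𝕍 → Source | Function.Injective (labels y)} =
          ⋂ v, ⋂ w, ⋂ (_ : v ≠ w), {y | labels y v = labels y w}ᶜ := by
        ext y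
        simp only [Set.mem_ofPred_eq, Set.mem_iInter, Set.mem_compl_iff]
        exact ⟨fun h v w hvw h' => hvw (h h'), fun h v w h' => by_contra fun hvw => h v w hvw h'⟩
      rw [this]
      refine .iInter fun v => .iInter fun w => .iInter fun _ => (measurableSet_eq_fun ?_ ?_).compl
      · exact (measurable_pi_apply v).comp measurable_labels
      · exact (measurable_pi_apply w).comp measurable_labels
    · exact hy.comp (MulAction.injective γ⁻¹)

end IsHeatBath

end Limit

/-! ### Almost sure stabilisation from tightness -/

section Stabilisation

theorem exists_finset_measure_compl_le {S : Type*} [MeasurableSpace S] [MeasurableSingletonClass S]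
    [Countable S] (p : Measure S) [IsFiniteMeasure p] {ε : ENNReal} (hε : ε ≠ 0) :
    ∃ F : Finset S, p (F : Set S)ᶜ < ε := by
  classical
  have h := tendsto_measure_iInter_atTop (μ := p) (s := fun F : Finset S => (F : Set S)ᶜ)
    (fun F => (MeasurableSet.of_discrete).nullMeasurableSet)
    (fun F F' h => Set.compl_subset_compl.2 (Finset.coe_subset.2 h)) ⟨∅, measure_ne_top _ _⟩
  have h0 : ⋂ F : Finset S, ((F : Set S)ᶜ) = ∅ := by
    refine Set.eq_empty_of_forall_notMem fun s hs => ?_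
    exact Set.mem_iInter.1 hs {s} (by simp)
  rw [h0, measure_empty] at h
  exact (h.eventually_lt_const (pos_iff_ne_zero.2 hε)).exists

variable {Γ 𝕍 S : Type*} [Group Γ] [MulAction Γ 𝕍] [Countable 𝕍] [Countable S]
  [MeasurableSpace S] [MeasurableSingletonClass S] {B : Set (𝕍 → S)} [Countable B]
  [LinearOrder S] {ρ : Specification B} {f : 𝕍 → ℝ → B → B}

namespace IsHeatBath

variable (hf : IsHeatBath Γ ρ f)
include hf

theorem ae_run_eventually_eq (hB : ∀ τ ∈ B, ∀ V, agreeOff V τ ⊆ B) {τ : B}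
    (htop : ∀ v, IsTop (τ.1 v)) (hirr : ρ.IrreducibleAt τ) (V : Finset 𝕍) (t : 𝕍 → ℝ) (v : 𝕍) :
    ∀ᵐ u ∂noiseLaw 𝕍, ∃ s, ∀ᶠ n in atTop, (run f τ V n t u).1 v = s := by
  have := ρ.isProbabilityMeasure_stateLaw V τ hB
  have hτ : ρ.stateLaw V τ {τ} ≠ 0 := by
    rw [ρ.stateLaw_singleton]; exact (hirr V).1
  have hev : Measurable fun x : B => x.1 v := .of_discrete
  refine ae_exists_eventually_eq (fun u n n' h => ?_) fun ε hε => ?_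
  · exact hf.run_antitone htop t u (show ((V, n) : Finset 𝕍 × ℕ) ≤ (V, n') from ⟨le_rfl, h⟩) v
  · have : IsFiniteMeasure ((ρ.stateLaw V τ).map fun x : B => x.1 v) := inferInstance
    -- The tolerance is divided by the constant of `map_run_le`, so that one `F` serves all `n`.
    obtain ⟨F, hF⟩ := exists_finset_measure_compl_le ((ρ.stateLaw V τ).map fun x : B => x.1 v)
      (ε := ε / (ρ.stateLaw V τ {τ})⁻¹) (ENNReal.div_ne_zero.2 ⟨hε, ENNReal.inv_ne_top.2 hτ⟩)
    rw [Measure.map_apply hev .of_discrete] at hF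
    refine ⟨F, fun n => ⟨n, le_rfl, ?_⟩⟩
    calc noiseLaw 𝕍 {u | (run f τ V n t u).1 v ∉ F}
        = (noiseLaw 𝕍).map (run f τ V n t) {x | x.1 v ∉ F} :=
          (Measure.map_apply (hf.measurable_run τ V n t)
            (MeasurableSet.of_discrete (s := {x : B | x.1 v ∉ F}))).symm
      _ ≤ (ρ.stateLaw V τ {τ})⁻¹ * ρ.stateLaw V τ {x | x.1 v ∉ F} :=
          hf.map_run_le hB hτ n t _
      _ ≤ (ρ.stateLaw V τ {τ})⁻¹ * (ε / (ρ.stateLaw V τ {τ})⁻¹) := by gcongr; exact hF.le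
      _ ≤ ε := ENNReal.mul_div_le

theorem tendsto_measureReal_boxState (hB : ∀ τ ∈ B, ∀ V, agreeOff V τ ⊆ B) {τ : B}
    (hirr : ρ.IrreducibleAt τ) (V : Finset 𝕍)
    (hconv : ∀ t, ∀ᵐ u ∂noiseLaw 𝕍, ∀ v ∈ V, ∃ s, ∀ᶠ n in atTop, (run f τ V n t u).1 v = s)
    {A : Set (𝕍 → S)} (hA : MeasurableSet A) :
    Tendsto (fun n => (iidLaw 𝕍 sourceLaw).real {y | (boxState f τ (V, n) y).1 ∈ A}) atTop
      (𝓝 ((ρ.law V τ : Measure (𝕍 → S)).real A)) := by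
  have hA' : MeasurableSet {x : B | x.1 ∈ A} := .of_discrete
  have h := hf.tendsto_integral_boxState hB hirr V hconv
    (Set.indicator {x : B | x.1 ∈ A} fun _ => (1 : ℝ)) (c := 1) fun x => by
      by_cases hx : x ∈ {x : B | x.1 ∈ A} <;> simp [hx]
  rw [← ρ.map_val_stateLaw V τ hB, map_measureReal_apply measurable_subtype_coe hA]
  rw [integral_indicator_const _ hA', smul_eq_mul, mul_one] at h
  refine h.congr fun n => ?_
  have := integral_indicator_const (μ := iidLaw 𝕍 sourceLaw) (1 : ℝ)
    (hf.measurable_boxState τ (V, n) hA')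
  rw [smul_eq_mul, mul_one] at this
  exact this

/-- A finite `F` carries all but `ε` of the marginal of `μ` at `v`. Beyond any given box, weak
convergence on the clopen event of missing `F` supplies a volume, and convergence in that volume
supplies a time, at which `F` is missed with probability at most `ε`. -/
theorem ae_boxState_eventually_eq [TopologicalSpace S] [DiscreteTopology S] [BorelSpace S]
    (hB : ∀ τ ∈ B, ∀ V, agreeOff V τ ⊆ B) {τ : B} (htop : ∀ v, IsTop (τ.1 v))
    (hirr : ρ.IrreducibleAt τ) {μ : ProbabilityMeasure (𝕍 → S)} (hμ : ρ.IsLimit τ μ) (v : 𝕍) :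
    ∀ᵐ y ∂iidLaw 𝕍 sourceLaw, ∃ s, ∀ᶠ i in atTop, (boxState f τ i y).1 v = s := by
  classical
  refine ae_exists_eventually_eq (fun y i j h => hf.run_antitone htop _ _ h v) fun ε hε => ?_
  have hev : Measurable fun ω : 𝕍 → S => ω v := measurable_pi_apply v
  obtain ⟨F, hF⟩ := exists_finset_measure_compl_le ((μ : Measure (𝕍 → S)).map fun ω => ω v) hε
  rw [Measure.map_apply hev .of_discrete] at hF
  set A : Set (𝕍 → S) := (fun ω : 𝕍 → S => ω v) ⁻¹' (F : Set S)ᶜ with hA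
  have hAm : MeasurableSet A := hev .of_discrete
  have hAc : IsClopen A := (isClopen_discrete _).preimage (continuous_apply v)
  refine ⟨F, fun ⟨V₀, n₀⟩ => ?_⟩
  have h1 := ProbabilityMeasure.tendsto_measure_of_null_frontier_of_tendsto' hμ (E := A)
    (by rw [hAc.frontier_eq, measure_empty])
  obtain ⟨V, hV, hVε⟩ := ((eventually_ge_atTop V₀).and (h1.eventually_lt_const hF)).exists
  have h2 := hf.tendsto_measureReal_boxState hB hirr V
    (fun t => (ae_ball_iff V.countable_toSet).2 fun w _ =>
      hf.ae_run_eventually_eq hB htop hirr V t w) hAm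
  have h3 := (ENNReal.tendsto_toReal_iff (fun _ => measure_ne_top _ _) (measure_ne_top _ _)).1 h2
  obtain ⟨n, hn, hnε⟩ := ((eventually_ge_atTop n₀).and (h3.eventually_lt_const hVε)).exists
  exact ⟨(V, n), ⟨hV, hn⟩, hnε.le⟩

end IsHeatBath

end Stabilisation

/-! ### The coding radius for finite spin spaces -/

section CodingRadius

variable {Γ 𝕍 S : Type*} [Group Γ] [MulAction Γ 𝕍] [Countable 𝕍] [Finite S]
  [MeasurableSpace S] [MeasurableSingletonClass S] {B : Set (𝕍 → S)} [Countable B]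
  [LinearOrder S] {ρ : Specification B} {f : 𝕍 → ℝ → B → B}

/-- The excess of `p` on `A` equals its deficit on the complement, so the sum of absolute
differences counts it twice; this absorbs the factor `1/2`. -/
theorem measureReal_sub_le_tvDist (p q : Measure S) [IsProbabilityMeasure p]
    [IsProbabilityMeasure q] (A : Set S) : p.real A - q.real A ≤ tvDist p q := by
  classical
  have := Fintype.ofFinite S
  have hsum : ∀ (m : Measure S) [IsProbabilityMeasure m] (E : Set S),
      m.real E = ∑ s, if s ∈ E then m.real {s} else 0 := by
    intro m _ E
    rw [← Finset.sum_filter, sum_measureReal_singleton]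
    simp
  have hcompl : p.real A - q.real A = q.real Aᶜ - p.real Aᶜ := by
    rw [probReal_compl_eq_one_sub .of_discrete, probReal_compl_eq_one_sub .of_discrete]
    ring
  have : p.real A - q.real A + (q.real Aᶜ - p.real Aᶜ) ≤ ∑ s, |p.real {s} - q.real {s}| := by
    rw [hsum p A, hsum q A, hsum p Aᶜ, hsum q Aᶜ, ← Finset.sum_sub_distrib,
      ← Finset.sum_sub_distrib, ← Finset.sum_add_distrib]
    refine Finset.sum_le_sum fun s _ => ?_
    by_cases hs : s ∈ A
    · simpa [hs] using le_abs_self (p.real {s} - q.real {s})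
    · simpa [hs] using (le_abs_self (q.real {s} - p.real {s})).trans_eq
        (abs_sub_comm (q.real {s}) (p.real {s}))
  rw [tvDist, tsum_fintype]
  linarith

/-- Where `Y < X`, the threshold `s = X` separates the two and is not the minimum. Omitting the
minimum is the source of the factor `|S| - 1`. -/
theorem measureReal_ne_le {Ω : Type*} [MeasurableSpace Ω] [Fintype S] [OrderBot S] (P : Measure Ω)
    [IsFiniteMeasure P] {X Y : Ω → S} (hY : Measurable Y) (hYX : ∀ ω, Y ω ≤ X ω) :
    P.real {ω | X ω ≠ Y ω} ≤
      ∑ s ∈ Finset.univ.erase ⊥, (P.real {ω | s ≤ X ω} - P.real {ω | s ≤ Y ω}) := by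
  have hsub : {ω | X ω ≠ Y ω} ⊆
      ⋃ s ∈ Finset.univ.erase (⊥ : S), {ω | s ≤ X ω} \ {ω | s ≤ Y ω} := by
    intro ω hω
    have hlt : Y ω < X ω := lt_of_le_of_ne (hYX ω) (Ne.symm hω)
    simp only [Set.mem_iUnion]
    exact ⟨X ω, Finset.mem_erase.2 ⟨(bot_le.trans_lt hlt).ne', Finset.mem_univ _⟩, le_refl (X ω),
      not_le.2 hlt⟩
  refine (measureReal_mono hsub (measure_ne_top _ _)).trans
    ((measureReal_biUnion_finset_le _ _).trans_eq ?_)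
  refine Finset.sum_congr rfl fun s _ => ?_
  exact measureReal_sdiff (fun ω (h : s ≤ Y ω) => h.trans (hYX ω))
    (hY (t := Set.Ici s) .of_discrete)

namespace IsHeatBath

variable (hf : IsHeatBath Γ ρ f)
include hf

theorem exists_boxState_eventually_eq {τ : B} (htop : ∀ v, IsTop (τ.1 v)) (y : 𝕍 → Source) (v : 𝕍) :
    ∃ s, ∀ᶠ i in atTop, (boxState f τ i y).1 v = s := by
  classical
  exact Antitone.exists_eventually_eq_of_finite fun i j h => hf.run_antitone htop _ _ h v

theorem exists_run_eventually_eq_of_isTop {τ : B} (htop : ∀ v, IsTop (τ.1 v)) (V : Finset 𝕍)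
    (t : 𝕍 → ℝ) (u : 𝕍 × ℕ → ℝ) (v : 𝕍) : ∃ s, ∀ᶠ n in atTop, (run f τ V n t u).1 v = s :=
  Antitone.exists_eventually_eq_of_finite fun n n' h => hf.run_antitone htop t u
    (show ((V, n) : Finset 𝕍 × ℕ) ≤ (V, n') from ⟨le_rfl, h⟩) v

theorem exists_run_eventually_eq_of_isBot {τ : B} (hbot : ∀ v, IsBot (τ.1 v)) (V : Finset 𝕍)
    (t : 𝕍 → ℝ) (u : 𝕍 × ℕ → ℝ) (v : 𝕍) : ∃ s, ∀ᶠ n in atTop, (run f τ V n t u).1 v = s :=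
  Monotone.exists_eventually_eq_of_finite fun n n' h => hf.run_monotone hbot t u
    (show ((V, n) : Finset 𝕍 × ℕ) ≤ (V, n') from ⟨le_rfl, h⟩) v

theorem limitState_mem_Icc {τ τ' : B} (htop : ∀ v, IsTop (τ.1 v)) (hbot : ∀ v, IsBot (τ'.1 v))
    (i : Finset 𝕍 × ℕ) (y : 𝕍 → Source) (v : 𝕍) :
    limitState f τ y v ∈ Set.Icc ((boxState f τ' i y).1 v) ((boxState f τ i y).1 v) := by
  classical
  obtain ⟨j, hj, hij⟩ := ((eventually_eq_eventualValue (τ.1 v)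
    (hf.exists_boxState_eventually_eq htop y v)).and (eventually_ge_atTop i)).exists
  rw [limitState, ← hj]
  exact ⟨hf.run_bot_le_run_top htop hbot _ _ _ _ _ _ v, hf.run_antitone htop _ _ hij v⟩

/-- The two runs in the ball are the same for `y` and `y'`, and they enclose the limit at `v` for
both. -/
theorem determinedAt {G : SimpleGraph 𝕍} (hG : IsLocallyFinite G) {τ τ' : B}
    (htop : ∀ v, IsTop (τ.1 v)) (hbot : ∀ v, IsBot (τ'.1 v)) {v : 𝕍} {r n : ℕ} {y : 𝕍 → Source}
    (h : (boxState f τ (ball hG v r, n) y).1 v = (boxState f τ' (ball hG v r, n) y).1 v) :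
    DeterminedAt G (limitState f τ) v y r := by
  intro y' hy'
  have hy : ∀ w ∈ ball hG v r, y w = y' w := fun w hw =>
    hy' w ((ballSet_finite hG v r).mem_toFinset.1 hw)
  have hbox : ∀ σ : B, boxState f σ (ball hG v r, n) y = boxState f σ (ball hG v r, n) y' :=
    fun σ => run_congr f σ (fun w hw => congrFun (hy w hw) none)
      fun j hj => congrFun (hy j.1 hj) (some j.2)
  have h1 := hf.limitState_mem_Icc htop hbot (ball hG v r, n) y v
  have h2 := hf.limitState_mem_Icc htop hbot (ball hG v r, n) y' v
  rw [← hbox, ← hbox] at h2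
  rw [← h, Set.Icc_self, Set.mem_singleton_iff] at h1 h2
  rw [h1, h2]

/-- The coding radius exceeds `r` only if the maximal and minimal boundary conditions on the ball
of radius `r` are distinguished at its centre. -/
theorem measureReal_codingRadius_le [OrderBot S] {G : SimpleGraph 𝕍} (hG : IsLocallyFinite G)
    (hB : ∀ τ ∈ B, ∀ V, agreeOff V τ ⊆ B) {τ τ' : B}
    (htop : ∀ v, IsTop (τ.1 v)) (hbot : ∀ v, IsBot (τ'.1 v)) (hirr : ρ.IrreducibleAt τ)
    (hirr' : ρ.IrreducibleAt τ') (v : 𝕍) (r : ℕ) :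
    (iidLaw 𝕍 sourceLaw).real {y | (r : ℕ∞) < codingRadius G (limitState f τ) v y} ≤
      ((Nat.card S : ℝ) - 1) * tvDist
        ((ρ.law (ball hG v r) τ : Measure (𝕍 → S)).map fun σ => σ v)
        ((ρ.law (ball hG v r) τ' : Measure (𝕍 → S)).map fun σ => σ v) := by
  classical
  have := Fintype.ofFinite S
  have hev : Measurable fun ω : 𝕍 → S => ω v := measurable_pi_apply v
  set V := ball hG v r with hV
  set p := (ρ.law V τ : Measure (𝕍 → S)).map fun σ => σ v with hp
  set q := (ρ.law V τ' : Measure (𝕍 → S)).map fun σ => σ v with hq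
  have hpp : IsProbabilityMeasure p := Measure.isProbabilityMeasure_map hev.aemeasurable
  have hqp : IsProbabilityMeasure q := Measure.isProbabilityMeasure_map hev.aemeasurable
  have hAm : ∀ s, MeasurableSet {ω : 𝕍 → S | s ≤ ω v} := fun s =>
    hev (t := Set.Ici s) .of_discrete
  have hreal : ∀ (V : Finset 𝕍) (σ : B) s, ((ρ.law V σ : Measure (𝕍 → S)).map fun σ => σ v).real
      (Set.Ici s) = (ρ.law V σ : Measure (𝕍 → S)).real {ω | s ≤ ω v} := fun V σ s =>
    map_measureReal_apply hev .of_discrete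
  have hlim : ∀ s, Tendsto
      (fun n => (iidLaw 𝕍 sourceLaw).real {y | s ≤ (boxState f τ (V, n) y).1 v} -
        (iidLaw 𝕍 sourceLaw).real {y | s ≤ (boxState f τ' (V, n) y).1 v}) atTop
      (𝓝 (p.real (Set.Ici s) - q.real (Set.Ici s))) := by
    intro s
    rw [hp, hq, hreal, hreal]
    have h1 := hf.tendsto_measureReal_boxState hB hirr V (fun t => .of_forall fun u w _ =>
      hf.exists_run_eventually_eq_of_isTop htop V t u w) (hAm s)
    have h2 := hf.tendsto_measureReal_boxState hB hirr' V (fun t => .of_forall fun u w _ =>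
      hf.exists_run_eventually_eq_of_isBot hbot V t u w) (hAm s)
    exact h1.sub h2
  have hle : (iidLaw 𝕍 sourceLaw).real {y | (r : ℕ∞) < codingRadius G (limitState f τ) v y} ≤
      ∑ s ∈ Finset.univ.erase (⊥ : S), (p.real (Set.Ici s) - q.real (Set.Ici s)) := by
    -- The left side is free of `n`, and its event is only ever enlarged, so it need not be
    -- measurable.
    refine ge_of_tendsto (tendsto_finsetSum _ fun s _ => hlim s) (.of_forall fun n => ?_)
    have hne := measureReal_ne_le (iidLaw 𝕍 sourceLaw)
      (X := fun y => (boxState f τ (V, n) y).1 v) (Y := fun y => (boxState f τ' (V, n) y).1 v)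
      (hev.comp (measurable_subtype_coe.comp (hf.measurable_boxState τ' (V, n))))
      fun y => hf.run_bot_le_run_top htop hbot _ _ _ _ _ _ v
    refine (measureReal_mono (fun y (hy : (r : ℕ∞) < codingRadius G _ v y) => ?_)
      (measure_ne_top _ _)).trans hne
    intro h
    exact not_le.2 hy (iInf₂_le r (hf.determinedAt hG htop hbot h))
  refine hle.trans ((Finset.sum_le_card_nsmul _ _ _ fun s _ =>
    measureReal_sub_le_tvDist p q (Set.Ici s)).trans_eq ?_)
  rw [Finset.card_erase_of_mem (Finset.mem_univ _), Finset.card_univ, Nat.card_eq_fintype_card,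
    nsmul_eq_mul, Nat.cast_sub Fintype.card_pos, Nat.cast_one]

end IsHeatBath

theorem tendsto_ball_atTop {G : SimpleGraph 𝕍} (hG : IsLocallyFinite G) (hconn : G.Connected)
    (v : 𝕍) : Tendsto (ball hG v) atTop atTop := by
  classical
  have hmem : ∀ w, ∃ r, ∀ r' ≥ r, w ∈ ball hG v r' := by
    intro w
    have hne : G.edist v w ≠ ⊤ := SimpleGraph.edist_ne_top_iff_reachable.2 (hconn.preconnected v w)
    obtain ⟨r, hr⟩ := ENat.ne_top_iff_exists.1 hne
    refine ⟨r, fun r' h => (ballSet_finite hG v r').mem_toFinset.2 ?_⟩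
    change G.edist v w ≤ r'
    rw [← hr]
    exact_mod_cast h
  refine tendsto_atTop.2 fun V => ?_
  have := (Filter.eventually_all_finset V (l := atTop) (p := fun w r => w ∈ ball hG v r)).2
    fun w _ => eventually_atTop.2 (hmem w)
  filter_upwards [this] with r hr w hw using hr w hw

theorem tendsto_tvDist_zero [TopologicalSpace S] [DiscreteTopology S] [BorelSpace S] {τ τ' : B}
    {μ : ProbabilityMeasure (𝕍 → S)} (hμ : ρ.IsLimit τ μ) (hμ' : ρ.IsLimit τ' μ) (v : 𝕍) :
    Tendsto (fun V => tvDist ((ρ.law V τ : Measure (𝕍 → S)).map fun σ => σ v)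
      ((ρ.law V τ' : Measure (𝕍 → S)).map fun σ => σ v)) atTop (𝓝 0) := by
  have := Fintype.ofFinite S
  have hev : Measurable fun ω : 𝕍 → S => ω v := measurable_pi_apply v
  have hlim : ∀ (σ : B), ρ.IsLimit σ μ → ∀ s, Tendsto
      (fun V => ((ρ.law V σ : Measure (𝕍 → S)).map fun σ => σ v).real {s}) atTop
      (𝓝 ((μ : Measure (𝕍 → S)).real ((fun ω : 𝕍 → S => ω v) ⁻¹' {s}))) := by
    intro σ hσ s
    have hc : IsClopen ((fun ω : 𝕍 → S => ω v) ⁻¹' {s}) :=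
      (isClopen_discrete _).preimage (continuous_apply v)
    simp_rw [map_measureReal_apply hev (measurableSet_singleton s)]
    exact (ENNReal.tendsto_toReal (measure_ne_top _ _)).comp
      (ProbabilityMeasure.tendsto_measure_of_null_frontier_of_tendsto' hσ
        (by rw [hc.frontier_eq, measure_empty]))
  simp only [tvDist, tsum_fintype]
  have h := (tendsto_finsetSum Finset.univ fun s (_ : s ∈ Finset.univ) =>
    ((hlim τ hμ s).sub (hlim τ' hμ' s)).abs).const_mul (1 / 2 : ℝ)
  simpa using h

end CodingRadius

end SpinSpec

/-! ### The main theorem -/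

theorem theorem2p1 {𝕍 Γ S : Type*} [Countable 𝕍] [Infinite 𝕍] [Group Γ] [MulAction Γ 𝕍]
    (G : SimpleGraph 𝕍) (hG : IsLocallyFinite G) (hconn : G.Connected)
    (haut : ActsByAut Γ G) (hqt : QuasiTransitive Γ 𝕍)
    [LinearOrder S] [OrderTop S] [Countable S]
    [TopologicalSpace S] [DiscreteTopology S] [MeasurableSpace S] [BorelSpace S] :
    (∀ ρ : UpSpecification 𝕍 S,
      ρ.Monotonic → ρ.Invariant Γ → ρ.IrreducibleAt (plus 𝕍 S) →
      ∀ μ : ProbabilityMeasure (𝕍 → S), ρ.IsLimit (plus 𝕍 S) μ →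
        IsFiid Γ (μ : Measure (𝕍 → S))) ∧
    (∀ [Finite S] [OrderBot S] (ρ : UpDownSpecification 𝕍 S),
      ρ.Monotonic → ρ.Invariant Γ →
      ρ.IrreducibleAt (udPlus 𝕍 S) → ρ.IrreducibleAt (udMinus 𝕍 S) →
      ∃ μp μm : ProbabilityMeasure (𝕍 → S),
        ρ.IsLimit (udPlus 𝕍 S) μp ∧ ρ.IsLimit (udMinus 𝕍 S) μm ∧
        ∃ (T : Type) (_ : MeasurableSpace T) (_ : StandardBorelSpace T)
          (ν : Measure T) (_ : IsProbabilityMeasure ν) (φ : (𝕍 → T) → (𝕍 → S)),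
          IsCoding Γ ν φ (μp : Measure (𝕍 → S)) ∧
          (∀ (v : 𝕍) (r : ℕ),
            (iidLaw 𝕍 ν).real {y | (r : ℕ∞) < codingRadius G φ v y} ≤
              ((Nat.card S : ℝ) - 1) *
                tvDist
                  ((ρ.law (ball hG v r) (udPlus 𝕍 S) : Measure (𝕍 → S)).map (fun σ => σ v))
                  ((ρ.law (ball hG v r) (udMinus 𝕍 S) : Measure (𝕍 → S)).map (fun σ => σ v))) ∧
          (μp = μm → IsFinitary G ν φ)) := by
  classical
  have hup : IsBoundarySet Γ (upConfigs 𝕍 S) := isBoundarySet_iUnion_agreeOff ⊤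
  refine ⟨fun ρ hmono hinv hirr μ hμ => ?_, fun ρ hmono hinv hirr hirr' => ?_⟩
  · have : Countable (upConfigs 𝕍 S) := hup.countable.to_subtype
    obtain ⟨f, hf⟩ := hmono.exists_isHeatBath hup hinv
    have htop : ∀ v, IsTop ((plus 𝕍 S).1 v) := fun v => isTop_top
    have h := hf.isLimit_map_limitState hup.agreeOff_subset hirr
      (fun V t => (ae_ball_iff V.countable_toSet).2 fun v _ =>
        hf.ae_run_eventually_eq hup.agreeOff_subset htop hirr V t v)
      (hf.ae_boxState_eventually_eq hup.agreeOff_subset htop hirr hμ)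
    rw [tendsto_nhds_unique hμ h]
    exact ⟨Source, inferInstance, inferInstance, sourceLaw, inferInstance, _,
      hf.isCoding fun γ => rfl⟩
  · have hdown : IsBoundarySet Γ (downConfigs 𝕍 S) := isBoundarySet_iUnion_agreeOff ⊥
    have hud := hup.union hdown
    have : Countable (upConfigs 𝕍 S ∪ downConfigs 𝕍 S : Set (𝕍 → S)) := hud.countable.to_subtype
    obtain ⟨f, hf⟩ := hmono.exists_isHeatBath hud hinv
    have htop : ∀ v, IsTop ((udPlus 𝕍 S).1 v) := fun v => isTop_top
    have hbot : ∀ v, IsBot ((udMinus 𝕍 S).1 v) := fun v => isBot_bot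
    have hp := hf.isLimit_map_limitState hud.agreeOff_subset hirr
      (fun V t => .of_forall fun u v _ => hf.exists_run_eventually_eq_of_isTop htop V t u v)
      (fun v => .of_forall fun y => hf.exists_boxState_eventually_eq htop y v)
    have hm := hf.isLimit_map_limitState hud.agreeOff_subset hirr'
      (fun V t => .of_forall fun u v _ => hf.exists_run_eventually_eq_of_isBot hbot V t u v)
      (fun v => .of_forall fun y => Monotone.exists_eventually_eq_of_finite fun i j h =>
        hf.run_monotone hbot _ _ h v)
    have hradius := hf.measureReal_codingRadius_le hG hud.agreeOff_subset htop hbot hirr hirr'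
    refine ⟨_, _, hp, hm, Source, inferInstance, inferInstance, sourceLaw, inferInstance, _,
      hf.isCoding fun γ => rfl, hradius, fun heq v => ?_⟩
    rw [← heq] at hm
    have hlim := ((tendsto_tvDist_zero hp hm v).comp (tendsto_ball_atTop hG hconn v)).const_mul
      ((Nat.card S : ℝ) - 1)
    rw [mul_zero] at hlim
    -- An infinite radius exceeds every `r`, so its probability is below a bound that vanishes as
    -- the balls exhaust the graph.
    rw [ae_iff, ← measureReal_eq_zero_iff]
    refine le_antisymm (ge_of_tendsto hlim (.of_forall fun r => ?_)) measureReal_nonneg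
    refine (measureReal_mono fun y hy => ?_).trans (hradius v r)
    exact (ENat.natCast_lt_top r).trans_le (not_lt.1 hy)
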